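/- **Setting.** Consider $N$ qubits with Hilbert space $(\mathbb{C}^2)^{\otimes N}$ and, for a unit vector $\vec n\in\mathbb{R}^3$, the collective spin $L_{\vec n}=\sum_{i=1}^N \tfrac12\,\vec n\cdot\vec\sigma^{(i)}$, where $\vec\sigma=(\sigma_x,\sigma_y,\sigma_z)$ are the Pauli matrices. For a state (density matrix) $\rho=\sum_k\lambda_k|\Phi_k\rangle\langle\Phi_k|$, with $\{\Phi_k\}$ an orthonormal eigenbasis, the quantum Fisher information is $$F_Q[\rho,A]=2\sum_{k,l:\ \lambda_k+\lambda_l>0}\frac{(\lambda_k-\lambda_l)^2}{\lambda_k+\lambda_l}\,|\langle\Phi_k|A|\Phi_l\rangle|^2 .$$ For a set $\mathcal R$ of states and a set $\Omega$ of axes let $$B(\mathcal R,\Omega)=\max_{\rho\in\mathcal R}\ \min_{\vec n\in\Omega}F_Q[\rho,L_{\vec n}].$$ Let $\mathcal S$ be the set of all states of the $N$ qubits and $\mathcal S_{\rm sep}$ the set of separable states $\sum_\gamma p_\gamma\,\rho^{(1)}_\gamma\otimes\cdots\otimes\rho^{(N)}_\gamma$ (finite mixtures). Let $\Omega=\mathbb{R}^3$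 stand for all unit vectors of $\mathbb{R}^3$, and $\Omega=\mathbb{R}^2$ for the unit vectors orthogonal to a fixed unit vector $\vec\nu$ (for $\vec\nu=\vec e_z$, the $xy$ plane). **Claim.** For every state $\rho$ the minimum over $\vec n$ exists in both cases. For every $N$, every $\rho\in\mathcal S$ and every $\rho_{\rm sep}\in\mathcal S_{\rm sep}$, $$\min_{\vec n\in\mathbb{R}^2}F_Q[\rho,L_{\vec n}]\le\tfrac N2(N+2),\qquad \min_{\vec n\in\mathbb{R}^3}F_Q[\rho,L_{\vec n}]\le\tfrac N3(N+2),$$ $$\min_{\vec n\in\mathbb{R}^2}F_Q[\rho_{\rm sep},L_{\vec n}]\le N,\qquad \min_{\vec n\in\mathbb{R}^3}F_Q[\rho_{\rm sep},L_{\vec n}]\le\tfrac23N .$$ These bounds are attained, as follows. 1. If $N$ is even, $B(\mathcal S,\mathbb{R}^2)=\frac N2(N+2)$. For any $N$, the value is attained by every twin-Fock state, that is, every unit vector $\psi$ of the permutation-symmetric subspace (collective spin $N/2$) with $L_{\vec\nu}\psi=0$; such states exist for even $N$. 2. If $N=4$ or $N\ge6$, $B(\mathcal S,\mathbb{R}^3)=\frac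 N3(N+2)$. For any $N$, the value is attained by every anti-coherent state (to second order), that is, every unit vector $\psi$ of the permutation-symmetric subspace for which $\langle L_{\vec n}\rangle_\psi$ and $\langle L_{\vec n}^2\rangle_\psi$ do not depend on the unit vector $\vec n\in\mathbb{R}^3$; such states exist for $N=4$ and all $N\ge6$. 3. For every $N$, $B(\mathcal S_{\rm sep},\mathbb{R}^2)=N$. Normalized eigenvectors of $L_{\vec\nu}$ with either extremal eigenvalue $\pm N/2$ exist; each of them is a product of $N$ identical qubit states polarized along $\pm\vec\nu$, and attains this value. 4. If $N\ge3$, $B(\mathcal S_{\rm sep},\mathbb{R}^3)=\frac23N$. For any $N$, the value is attained by every pure product state whose covariance matrix $\Gamma_{ab}=\frac12\langle L_aL_b+L_bL_a\rangle-\langle L_a\rangle\langle L_b\rangle$, $a,b\in\{x,y,z\}$, is a multiple of the identity; such states exist for all $N\ge3$. -/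

import Mathlib

open scoped Matrix ComplexOrder

noncomputable section

namespace SpinMetrology

/-- Operators on a finite-dimensional Hilbert space with orthonormal basis indexed by `ι`. -/
abbrev Op (ι : Type) := Matrix ι ι ℂ

/-- Computational basis labels of `N` qubits: the Hilbert space is `(ℂ²)^{⊗N} = ℂ^(Fin N → Fin 2)`. -/
abbrev QIdx (N : ℕ) := Fin N → Fin 2

/-- Quantum states: positive semidefinite matrices of trace one. -/
def IsState {ι : Type} [Fintype ι] (ρ : Op ι) : Prop :=
  ρ.PosSemidef ∧ ρ.trace = 1

/-- Unit vectors. -/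
def IsUnitVec {ι : Type} [Fintype ι] (ψ : ι → ℂ) : Prop :=
  star ψ ⬝ᵥ ψ = 1

/-- The rank-one operator `|ψ⟩⟨ψ|`. -/
def pureState {ι : Type} (ψ : ι → ℂ) : Op ι :=
  Matrix.vecMulVec ψ (star ψ)

/-- Quantum Fisher information
`F_Q[ρ, A] = 2 ∑_{k,l} (λ_k - λ_l)² / (λ_k + λ_l) |⟨Φ_k| A |Φ_l⟩|²`
for an eigendecomposition `ρ = ∑_k λ_k |Φ_k⟩⟨Φ_k|`, where the terms with `λ_k + λ_l = 0` are
omitted (in Lean, `x / 0 = 0`). The columns of `eigenvectorUnitary` are the `Φ_k`. The value for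
matrices `ρ` that are not Hermitian plays no role. -/
def qfi {ι : Type} [Fintype ι] [DecidableEq ι] (ρ A : Op ι) : ℝ :=
  open Classical in
  if h : ρ.IsHermitian then
    2 * ∑ k, ∑ l, (h.eigenvalues k - h.eigenvalues l) ^ 2 / (h.eigenvalues k + h.eigenvalues l) *
      ‖((h.eigenvectorUnitary : Op ι)ᴴ * A * (h.eigenvectorUnitary : Op ι)) k l‖ ^ 2
  else 0

/-- The Pauli matrices `σ_x, σ_y, σ_z`. -/
def pauli : Fin 3 → Op (Fin 2) :=
  ![!![0, 1; 1, 0], !![0, -Complex.I; Complex.I, 0], !![1, 0; 0, -1]]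

/-- `n · σ`. -/
def pauliAlong (n : EuclideanSpace ℝ (Fin 3)) : Op (Fin 2) :=
  ∑ a, (n a : ℂ) • pauli a

/-- The tensor product `A₁ ⊗ ⋯ ⊗ A_N` of one-qubit operators. -/
def tensorOp {N : ℕ} (A : Fin N → Op (Fin 2)) : Op (QIdx N) :=
  Matrix.of fun x y => ∏ i, A i (x i) (y i)

/-- The tensor product `φ₁ ⊗ ⋯ ⊗ φ_N` of one-qubit vectors. -/
def tensorVec {N : ℕ} (φ : Fin N → Fin 2 → ℂ) : QIdx N → ℂ :=
  fun x => ∏ i, φ i (x i)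

/-- The one-qubit operator `A` acting on qubit `i`. -/
def onSite {N : ℕ} (i : Fin N) (A : Op (Fin 2)) : Op (QIdx N) :=
  tensorOp (Function.update (fun _ => 1) i A)

/-- The collective spin along `n`: `L_n = ∑_i ½ n · σ^{(i)}`. -/
def collectiveSpin (N : ℕ) (n : EuclideanSpace ℝ (Fin 3)) : Op (QIdx N) :=
  ∑ i : Fin N, onSite i ((1 / 2 : ℂ) • pauliAlong n)

/-- The set of all states of `N` qubits. -/
def allStates (N : ℕ) : Set (Op (QIdx N)) :=
  {ρ | IsState ρ}

/-- The set of (fully) separable states of `N` qubits: finite mixtures of products of one-qubit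
states. -/
def sepStates (N : ℕ) : Set (Op (QIdx N)) :=
  {ρ | ∃ (K : ℕ) (p : Fin K → ℝ) (τ : Fin K → Fin N → Op (Fin 2)),
    (∀ g, 0 ≤ p g) ∧ ∑ g, p g = 1 ∧ (∀ g i, IsState (τ g i)) ∧
    ρ = ∑ g, (p g : ℂ) • tensorOp (τ g)}

/-- All rotation axes in three-dimensional space. -/
def allAxes : Set (EuclideanSpace ℝ (Fin 3)) :=
  {n | ‖n‖ = 1}

/-- The rotation axes in the plane orthogonal to `ν`; `ν = (0,0,1)` gives the `xy` plane. -/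
def planeAxes (ν : EuclideanSpace ℝ (Fin 3)) : Set (EuclideanSpace ℝ (Fin 3)) :=
  {n | ‖n‖ = 1 ∧ inner ℝ ν n = 0}

/-- The sensitivities `F_Q[ρ, L_n]`, `n ∈ Ω`. -/
def sensitivities {N : ℕ} (Ω : Set (EuclideanSpace ℝ (Fin 3))) (ρ : Op (QIdx N)) : Set ℝ :=
  (fun n => qfi ρ (collectiveSpin N n)) '' Ω

/-- The worst-case sensitivity `min_{n ∈ Ω} F_Q[ρ, L_n]`. -/
def worstCase {N : ℕ} (Ω : Set (EuclideanSpace ℝ (Fin 3))) (ρ : Op (QIdx N)) : ℝ :=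
  sInf (sensitivities Ω ρ)

/-- The sensitivity limit `B(R, Ω) = max_{ρ ∈ R} min_{n ∈ Ω} F_Q[ρ, L_n]`. -/
def sensitivityLimit {N : ℕ} (R : Set (Op (QIdx N))) (Ω : Set (EuclideanSpace ℝ (Fin 3))) : ℝ :=
  sSup (worstCase Ω '' R)

/-- Vectors in the permutation-symmetric subspace, that is, with collective spin `N/2`. -/
def IsSymmetricVec {N : ℕ} (ψ : QIdx N → ℂ) : Prop :=
  ∀ (π : Equiv.Perm (Fin N)) (x : QIdx N), ψ (x ∘ π) = ψ x

/-- Twin-Fock states for the quantization axis `ν`: normalized vectors of collective spin `N/2`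
with `L_ν ψ = 0`. -/
def IsTwinFock {N : ℕ} (ν : EuclideanSpace ℝ (Fin 3)) (ψ : QIdx N → ℂ) : Prop :=
  IsUnitVec ψ ∧ IsSymmetricVec ψ ∧ collectiveSpin N ν *ᵥ ψ = 0

/-- Anti-coherent states (to second order): normalized vectors of collective spin `N/2` for which
`⟨L_n⟩` and `⟨L_n²⟩` do not depend on the direction `n`. -/
def IsAnticoherent {N : ℕ} (ψ : QIdx N → ℂ) : Prop :=
  IsUnitVec ψ ∧ IsSymmetricVec ψ ∧
    ∀ k ∈ ({1, 2} : Set ℕ), ∀ m ∈ allAxes, ∀ n ∈ allAxes,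
      star ψ ⬝ᵥ (collectiveSpin N m ^ k *ᵥ ψ) = star ψ ⬝ᵥ (collectiveSpin N n ^ k *ᵥ ψ)

/-- The component `L_a` of the collective spin, `a ∈ {x, y, z}`. -/
def spinComponent (N : ℕ) (a : Fin 3) : Op (QIdx N) :=
  collectiveSpin N (EuclideanSpace.single a 1)

/-- The spin covariance matrix `Γ_{ab} = ½ ⟨L_a L_b + L_b L_a⟩ - ⟨L_a⟩ ⟨L_b⟩`. -/
def spinCovariance {N : ℕ} (ρ : Op (QIdx N)) : Matrix (Fin 3) (Fin 3) ℝ :=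
  Matrix.of fun a b =>
    (1 / 2) * (ρ * (spinComponent N a * spinComponent N b +
        spinComponent N b * spinComponent N a)).trace.re -
      (ρ * spinComponent N a).trace.re * (ρ * spinComponent N b).trace.re

/-- Pure product states whose spin covariance matrix is diagonal, with equal variances in the
three directions. -/
def IsIsotropicProduct {N : ℕ} (ψ : QIdx N → ℂ) : Prop :=
  (∃ φ : Fin N → Fin 2 → ℂ, (∀ i, IsUnitVec (φ i)) ∧ ψ = tensorVec φ) ∧
    ∃ c : ℝ, spinCovariance (pureState ψ) = c • (1 : Matrix (Fin 3) (Fin 3) ℝ)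

/-- Normalized eigenvectors of `L_ν` for the extremal eigenvalue `s N/2`, `s = ±1`. -/
def IsExtremal {N : ℕ} (ν : EuclideanSpace ℝ (Fin 3)) (s : ℝ) (ψ : QIdx N → ℂ) : Prop :=
  IsUnitVec ψ ∧ collectiveSpin N ν *ᵥ ψ = ((s * (N / 2) : ℝ) : ℂ) • ψ

/-- `v` is the maximum `max_{ρ ∈ R} min_{n ∈ Ω} F_Q[ρ, L_n]`, it is attained, and it is the
value of `B(R, Ω)`. -/
def LimitAttained {N : ℕ} (R : Set (Op (QIdx N))) (Ω : Set (EuclideanSpace ℝ (Fin 3)))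
    (v : ℝ) : Prop :=
  sensitivityLimit R Ω = v ∧ IsGreatest (worstCase Ω '' R) v

end SpinMetrology

end

namespace SpinMetrology

/-! ### Traces against positive operators -/

section Trace

variable {ι : Type} [Fintype ι]

/-! A minimum over axes is at most the average over mutually orthogonal axes, and such averages can
be bounded independently of the state. Four times the second moment of an observable bounds the
quantum Fisher information. Summed over an orthonormal frame, the second moments give the Casimir
operator `totalSpinSq`, whose expectation is at most N(N+2)/4. Dividing by three gives the spatial
bound; for a plane the nonnegative moment along ν is dropped and the rest divided by two.

The Casimir bound is Schur–Weyl duality in miniature: by the identity ∑ₐ σₐ⊗σₐ = 2·SWAP − 1, the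
squared total spin is an affine function of the sum of all transpositions. Each transposition is a
contraction, and on symmetric vectors each acts as 1, which is where the bound is saturated.

For separable states the second moment is too crude and the variance is needed. With X the symmetric
logarithmic derivative, `exists_qfi_eq` writes the Fisher information as tr ρ(2i[A,X] − X²), which
is linear in ρ once X is fixed. Each component of a mixture contributes at most four times its own
variance, because a square is positive (`qfi_mixture_le`). For pure product states variances add
over the qubits, and Parseval for the unit Bloch vectors makes the sum over a frame equal to N/2.

Saturation uses `qfi_pureState`. Twin-Fock states work because expectations of commutators with L_ν
vanish; anti-coherent states and isotropic products work by definition, once a trace fixes the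
constant. The existence claims become elementary constructions: a Dicke state rotated to the axis ν,
Bloch vectors equally spaced on a cone, and, for anti-coherence, a superposition of Dicke states
with weights so far apart that ladder operators have no matrix elements between them. The last
leaves only a moment problem for a probability distribution on {0,…,N}. -/

lemma trace_pureState_mul (ψ : ι → ℂ) (A : Op ι) :
    (pureState ψ * A).trace = star ψ ⬝ᵥ (A *ᵥ ψ) := by
  rw [pureState, Matrix.vecMulVec_mul, Matrix.trace_vecMulVec, Matrix.dotProduct_mulVec,
    dotProduct_comm]

lemma posSemidef_pureState (ψ : ι → ℂ) : (pureState ψ).PosSemidef :=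
  Matrix.posSemidef_vecMulVec_self_star ψ

lemma isState_pureState {ψ : ι → ℂ} (h : IsUnitVec ψ) : IsState (pureState ψ) := by
  refine ⟨posSemidef_pureState ψ, ?_⟩
  rw [pureState, Matrix.trace_vecMulVec, dotProduct_comm]
  exact h

lemma pureState_mul_mul_pureState (ψ : ι → ℂ) (A : Op ι) :
    pureState ψ * A * pureState ψ = (pureState ψ * A).trace • pureState ψ := by
  rw [trace_pureState_mul, Matrix.dotProduct_mulVec, pureState, Matrix.vecMulVec_mul,
    Matrix.vecMulVec_mul_vecMulVec]
  ext i j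
  simp [Matrix.vecMulVec_apply]
  ring

lemma pureState_mul_self {ψ : ι → ℂ} (h : IsUnitVec ψ) :
    pureState ψ * pureState ψ = pureState ψ := by
  classical
  have := pureState_mul_mul_pureState ψ 1
  rwa [mul_one, (isState_pureState h).2, one_smul] at this

/-- Writing ρ = B*B turns the trace into a sum of quadratic forms of `A` in the conjugated rows of
B. Only real parts are assumed nonnegative, so `A` need not be known to be Hermitian. -/
lemma trace_mul_nonneg_of_forall {ρ A : Op ι} (hρ : ρ.PosSemidef)
    (hA : ∀ v : ι → ℂ, 0 ≤ (star v ⬝ᵥ (A *ᵥ v)).re) : 0 ≤ (ρ * A).trace.re := by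
  classical
  open scoped MatrixOrder Matrix.Norms.L2Operator in
  obtain ⟨B, rfl⟩ := (CStarAlgebra.nonneg_iff_eq_star_mul_self (A := Matrix ι ι ℂ)).mp hρ.nonneg
  rw [Matrix.star_eq_conjTranspose, Matrix.mul_assoc, Matrix.trace_mul_comm, Matrix.trace,
    Complex.re_sum]
  refine Finset.sum_nonneg fun k _ => ?_
  refine (hA (fun i => star (B k i))).trans_eq (congrArg Complex.re ?_)
  rw [Matrix.diag_apply, Matrix.mul_assoc, Matrix.mul_apply]
  simp only [dotProduct, Pi.star_apply, star_star]
  refine Finset.sum_congr rfl fun i _ => ?_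
  rw [Matrix.mul_apply]
  rfl

lemma trace_mul_conjTranspose_mul_self_nonneg {ρ : Op ι} (hρ : ρ.PosSemidef) (Y : Op ι) :
    0 ≤ (ρ * (Yᴴ * Y)).trace.re := by
  refine trace_mul_nonneg_of_forall hρ fun v => ?_
  exact (Complex.le_def.mp ((Matrix.posSemidef_conjTranspose_mul_self Y).dotProduct_mulVec_nonneg v)).1

/-- The trace of a product of two Hermitian operators is real. -/
lemma trace_mul_im_eq_zero {ρ A : Op ι} (hρ : ρ.IsHermitian) (hA : A.IsHermitian) :
    (ρ * A).trace.im = 0 := by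
  have h : star (ρ * A).trace = (ρ * A).trace := by
    rw [← Matrix.trace_conjTranspose, Matrix.conjTranspose_mul, hρ.eq, hA.eq,
      Matrix.trace_mul_comm]
  exact Complex.conj_eq_iff_im.mp h

/-- The variance of the observable `A` in the state `ρ`. -/
def variance (ρ A : Op ι) : ℝ :=
  (ρ * (A * A)).trace.re - (ρ * A).trace.re ^ 2

end Trace

/-! ### Quantum Fisher information -/

section QFI

variable {ι : Type} [Fintype ι] [DecidableEq ι]

lemma mul_swap_of_isHermitian {κ : Type} {B : Op κ} (hB : B.IsHermitian) (k l : κ) :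
    B k l * B l k = ((‖B k l‖ ^ 2 : ℝ) : ℂ) := by
  rw [← hB.apply l k, Complex.star_def, Complex.mul_conj']
  push_cast
  rfl

/-- The quantum Fisher information in terms of an abstract eigendecomposition. -/
lemma exists_eigendecomposition {ρ : Op ι} (h : ρ.IsHermitian) :
    ∃ (U : Op ι) (lam : ι → ℝ), U * Uᴴ = 1 ∧ Uᴴ * U = 1 ∧
      ρ = U * Matrix.diagonal (fun k => (lam k : ℂ)) * Uᴴ ∧
      ∀ A, qfi ρ A = 2 * ∑ k, ∑ l, (lam k - lam l) ^ 2 / (lam k + lam l) *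
        ‖(Uᴴ * A * U) k l‖ ^ 2 := by
  refine ⟨(h.eigenvectorUnitary : Op ι), h.eigenvalues,
    Unitary.mul_star_self_of_mem h.eigenvectorUnitary.2,
    Unitary.star_mul_self_of_mem h.eigenvectorUnitary.2, ?_, fun A => ?_⟩
  · have := h.spectral_theorem
    rwa [Unitary.conjStarAlgAut_apply] at this
  · rw [qfi, dif_pos h]

/-- The trace `tr (ρ A B)` in an eigenbasis of `ρ`. -/
lemma trace_mul_mul_eigenbasis {U : Op ι} {lam : ι → ℝ} (hU : U * Uᴴ = 1) (A B : Op ι) :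
    (U * Matrix.diagonal (fun k => (lam k : ℂ)) * Uᴴ * (A * B)).trace =
      ∑ k, ∑ l, (lam k : ℂ) * ((Uᴴ * A * U) k l * (Uᴴ * B * U) l k) := by
  have e : U * Matrix.diagonal (fun k => (lam k : ℂ)) * Uᴴ * (A * B) =
      U * (Matrix.diagonal (fun k => (lam k : ℂ)) * (Uᴴ * A * U) * (Uᴴ * B)) := by
    calc _ = U * Matrix.diagonal (fun k => (lam k : ℂ)) * Uᴴ * (A * 1 * B) := by
          rw [Matrix.mul_one]
      _ = _ := by rw [← hU]; simp only [Matrix.mul_assoc]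
  rw [e, Matrix.trace_mul_comm, Matrix.mul_assoc, Matrix.mul_assoc, Matrix.trace]
  refine Finset.sum_congr rfl fun k _ => ?_
  rw [Matrix.diag_apply, Matrix.diagonal_mul, Matrix.mul_apply, Finset.mul_sum]

/-- The quantum Fisher information as the value of a functional that is affine in the state. -/
lemma exists_qfi_eq {ρ A : Op ι} (hρ : ρ.IsHermitian) (hA : A.IsHermitian) :
    ∃ X : Op ι, X.IsHermitian ∧ qfi ρ A =
      (ρ * ((2 * Complex.I) • (A * X - X * A) - X * X)).trace.re := by
  obtain ⟨U, lam, hU, hU', hD, hq⟩ := exists_eigendecomposition hρ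
  set B : Op ι := Uᴴ * A * U with hB
  have hBh : B.IsHermitian := Matrix.isHermitian_conjTranspose_mul_mul U hA
  -- The symmetric logarithmic derivative of θ ↦ exp(−iθA) ρ exp(iθA) in the eigenbasis of ρ. Where
  -- the eigenvalue sum vanishes, division by zero gives entry 0, matching the omitted terms of
  -- `qfi`.
  set Y : Op ι := Matrix.of fun k l =>
    (2 * Complex.I * (((lam k - lam l) / (lam k + lam l) : ℝ) : ℂ)) * B k l with hY
  have hYh : Y.IsHermitian := by
    ext k l
    simp only [hY, Matrix.conjTranspose_apply, Matrix.of_apply, star_mul', hBh.apply]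
    simp only [Complex.star_def, Complex.conj_ofReal, Complex.conj_I, map_ofNat]
    push_cast
    rw [add_comm (lam l : ℂ)]
    ring
  have h1 : Uᴴ * (U * Y * Uᴴ) * U = Y := by
    simp only [Matrix.mul_assoc, hU', Matrix.mul_one]
    rw [← Matrix.mul_assoc, hU', Matrix.one_mul]
  have sw : ∀ k l, B k l * B l k = ((‖B k l‖ ^ 2 : ℝ) : ℂ) := mul_swap_of_isHermitian hBh
  have nsw : ∀ k l, ‖B k l‖ = ‖B l k‖ := fun k l => by rw [← hBh.apply l k, norm_star]
  refine ⟨U * Y * Uᴴ, Matrix.isHermitian_mul_mul_conjTranspose U hYh, ?_⟩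
  have e1 := trace_mul_mul_eigenbasis (lam := lam) hU A (U * Y * Uᴴ)
  have e2 := trace_mul_mul_eigenbasis (lam := lam) hU (U * Y * Uᴴ) A
  have e3 := trace_mul_mul_eigenbasis (lam := lam) hU (U * Y * Uᴴ) (U * Y * Uᴴ)
  rw [← hD, h1, ← hB] at e1 e2
  rw [← hD, h1] at e3
  rw [Matrix.mul_sub, Matrix.mul_smul, Matrix.mul_sub, Matrix.trace_sub, Matrix.trace_smul,
    Matrix.trace_sub, e1, e2, e3, hq, ← hB]
  set w : ι → ι → ℝ := fun k l => (lam k - lam l) ^ 2 / (lam k + lam l) * ‖B k l‖ ^ 2 with hw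
  set v : ι → ι → ℝ := fun k l => (lam k - lam l) / (lam k + lam l) * ‖B k l‖ ^ 2 with hv
  set u : ι → ι → ℝ := fun k l => ((lam k - lam l) / (lam k + lam l)) ^ 2 * ‖B k l‖ ^ 2 with hu
  have vs : ∀ k l, v l k = - v k l := fun k l => by
    simp only [hv]; rw [nsw l k, add_comm (lam l)]; ring
  have us : ∀ k l, u l k = u k l := fun k l => by
    simp only [hu]; rw [nsw l k, add_comm (lam l)]; ring
  have c1 : ∑ k, ∑ l, (lam k : ℂ) * (B k l * Y l k) =
      ((∑ k, ∑ l, lam k * v l k : ℝ) : ℂ) * (2 * Complex.I) := by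
    push_cast
    simp only [Finset.sum_mul]
    refine Finset.sum_congr rfl fun k _ => Finset.sum_congr rfl fun l _ => ?_
    simp only [hY, Matrix.of_apply, hv]
    rw [nsw l k]
    have := sw k l
    push_cast at this ⊢
    rw [← this]; ring
  have c2 : ∑ k, ∑ l, (lam k : ℂ) * (Y k l * B l k) =
      ((∑ k, ∑ l, lam k * v k l : ℝ) : ℂ) * (2 * Complex.I) := by
    push_cast
    simp only [Finset.sum_mul]
    refine Finset.sum_congr rfl fun k _ => Finset.sum_congr rfl fun l _ => ?_
    simp only [hY, Matrix.of_apply, hv]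
    have := sw k l
    push_cast at this ⊢
    rw [← this]; ring
  have c3 : ∑ k, ∑ l, (lam k : ℂ) * (Y k l * Y l k) =
      ((∑ k, ∑ l, 4 * (lam k * u k l) : ℝ) : ℂ) := by
    push_cast
    refine Finset.sum_congr rfl fun k _ => Finset.sum_congr rfl fun l _ => ?_
    simp only [hY, Matrix.of_apply, hu]
    have := sw k l
    push_cast at this ⊢
    rw [← this, add_comm (lam l : ℂ)]
    linear_combination (-4 * lam k * ((lam k - lam l : ℂ) / (lam k + lam l)) ^ 2 *
      (B k l * B l k)) * Complex.I_sq
  rw [c1, c2, c3]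
  have f1 : (∑ k, ∑ l, lam k * v l k) = - ∑ k, ∑ l, lam k * v k l := by
    simp only [← Finset.sum_neg_distrib]
    refine Finset.sum_congr rfl fun k _ => Finset.sum_congr rfl fun l _ => ?_
    rw [vs k l, mul_neg]
  -- Symmetrization in (k, l): since `v` is antisymmetric, the weight 2λₖ may be replaced by λₖ −
  -- λₗ. In `f3` the symmetry of `u` replaces it by λₖ + λₗ. The commutator term is therefore twice
  -- the Fisher information and the square term once.
  have f2 : 2 * (∑ k, ∑ l, lam k * v k l) = ∑ k, ∑ l, w k l := by
    have : (∑ k, ∑ l, lam k * v k l) = - ∑ k, ∑ l, lam l * v k l := by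
      conv_lhs => rw [Finset.sum_comm]
      rw [← Finset.sum_neg_distrib]
      refine Finset.sum_congr rfl fun k _ => ?_
      rw [← Finset.sum_neg_distrib]
      refine Finset.sum_congr rfl fun l _ => ?_
      rw [vs k l]; ring
    rw [two_mul]; nth_rw 2 [this]
    rw [← sub_eq_add_neg, ← Finset.sum_sub_distrib]
    refine Finset.sum_congr rfl fun k _ => ?_
    rw [← Finset.sum_sub_distrib]
    refine Finset.sum_congr rfl fun l _ => ?_
    simp only [hv, hw]; ring
  have f3 : 2 * (∑ k, ∑ l, lam k * u k l) = ∑ k, ∑ l, w k l := by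
    have : (∑ k, ∑ l, lam k * u k l) = ∑ k, ∑ l, lam l * u k l := by
      conv_lhs => rw [Finset.sum_comm]
      refine Finset.sum_congr rfl fun k _ => Finset.sum_congr rfl fun l _ => ?_
      rw [us k l]
    rw [two_mul]; nth_rw 2 [this]
    rw [← Finset.sum_add_distrib]
    refine Finset.sum_congr rfl fun k _ => ?_
    rw [← Finset.sum_add_distrib]
    refine Finset.sum_congr rfl fun l _ => ?_
    simp only [hu, hw]
    rcases eq_or_ne (lam k + lam l) 0 with h0 | h0
    · simp [h0]
    · field_simp
  have f4 : (∑ k, ∑ l, 4 * (lam k * u k l)) = 4 * ∑ k, ∑ l, lam k * u k l := by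
    simp only [Finset.mul_sum]
  rw [f1, f4]
  change 2 * (∑ k, ∑ l, w k l) = _
  generalize (∑ k, ∑ l, lam k * v k l) = V at *
  generalize (∑ k, ∑ l, lam k * u k l) = T at *
  have : (2 * Complex.I) • (((-V : ℝ) : ℂ) * (2 * Complex.I) - (V : ℂ) * (2 * Complex.I)) -
      ((4 * T : ℝ) : ℂ) = ((8 * V - 4 * T : ℝ) : ℂ) := by
    push_cast
    rw [smul_eq_mul]
    ring_nf
    simp only [Complex.I_sq]
    ring
  rw [this, Complex.ofReal_re]
  linarith

/-- Convexity bound: the quantum Fisher information of a mixture is at most four times the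
average variance. -/
theorem qfi_mixture_le {κ : Type} [Fintype κ] {p : κ → ℝ} {σ : κ → Op ι} {A : Op ι}
    (hp : ∀ g, 0 ≤ p g) (hσ : ∀ g, IsState (σ g)) (hA : A.IsHermitian) :
    qfi (∑ g, (p g : ℂ) • σ g) A ≤ 4 * ∑ g, p g * variance (σ g) A := by
  have hρ : (∑ g, (p g : ℂ) • σ g).IsHermitian := by
    rw [Matrix.IsHermitian, Matrix.conjTranspose_sum]
    refine Finset.sum_congr rfl fun g _ => ?_
    rw [Matrix.conjTranspose_smul, (hσ g).1.isHermitian.eq, Complex.star_def, Complex.conj_ofReal]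
  obtain ⟨X, hX, h⟩ := exists_qfi_eq hρ hA
  rw [h, Finset.sum_mul, Matrix.trace_sum, Complex.re_sum, Finset.mul_sum]
  refine Finset.sum_le_sum fun g _ => ?_
  rw [Matrix.smul_mul, Matrix.trace_smul, smul_eq_mul, Complex.re_ofReal_mul]
  have key : (σ g * ((2 * Complex.I) • (A * X - X * A) - X * X)).trace.re ≤
      4 * variance (σ g) A := by
    set a : ℝ := (σ g * A).trace.re with ha
    -- Completing the square: with Z = X + 2i(A − a), Z*Z = 4(A − a)² − (2i[A,X] − X²), and the mean
    -- of (A − a)² is the variance. The same X serves all components, while the shift `a` is adapted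
    -- to each.
    have h0 := trace_mul_conjTranspose_mul_self_nonneg (hσ g).1
      (X + (2 * Complex.I) • (A - (a : ℂ) • 1))
    have e : (X + (2 * Complex.I) • (A - (a : ℂ) • (1 : Op ι)))ᴴ *
        (X + (2 * Complex.I) • (A - (a : ℂ) • 1)) =
        (4 : ℂ) • (A * A) - (8 * a : ℂ) • A + (4 * a ^ 2 : ℂ) • 1
          - ((2 * Complex.I) • (A * X - X * A) - X * X) := by
      have i2 : Complex.I * Complex.I = -1 := Complex.I_mul_I
      simp only [Matrix.conjTranspose_add, Matrix.conjTranspose_smul, Matrix.conjTranspose_sub,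
        Matrix.conjTranspose_one, hX.eq, hA.eq, star_mul', Complex.star_def, Complex.conj_I,
        Complex.conj_ofReal, map_ofNat, Matrix.add_mul, Matrix.mul_add, Matrix.sub_mul,
        Matrix.mul_sub, Matrix.smul_mul, Matrix.mul_smul, Matrix.mul_one, Matrix.one_mul]
      ext i j
      simp only [Matrix.add_apply, Matrix.sub_apply, Matrix.smul_apply, smul_eq_mul]
      linear_combination (-4 * (A * A) i j + 8 * a * A i j - 4 * a ^ 2 * (1 : Op ι) i j) * i2
    rw [e, Matrix.mul_sub, Matrix.trace_sub, Complex.sub_re, Matrix.mul_add, Matrix.mul_sub,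
      Matrix.mul_smul, Matrix.mul_smul, Matrix.mul_smul, Matrix.mul_one, Matrix.trace_add,
      Matrix.trace_sub, Matrix.trace_smul, Matrix.trace_smul, Matrix.trace_smul, (hσ g).2] at h0
    have e2 : ((4 : ℂ) • (σ g * (A * A)).trace - (8 * a : ℂ) • (σ g * A).trace +
        (4 * a ^ 2 : ℂ) • (1 : ℂ)).re = 4 * variance (σ g) A := by
      rw [variance, ← ha]
      have : (8 * a : ℂ) = ((8 * a : ℝ) : ℂ) := by push_cast; rfl
      have h' : (4 * a ^ 2 : ℂ) = ((4 * a ^ 2 : ℝ) : ℂ) := by push_cast; rfl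
      have h4 : (4 : ℂ) = ((4 : ℝ) : ℂ) := by push_cast; rfl
      rw [this, h', h4]
      simp only [smul_eq_mul, Complex.add_re, Complex.sub_re, Complex.re_ofReal_mul, ← ha,
        Complex.one_re]
      ring
    rw [e2] at h0
    linarith
  calc p g * _ ≤ p g * (4 * variance (σ g) A) := mul_le_mul_of_nonneg_left key (hp g)
    _ = _ := by ring

lemma qfi_le_four_mul_trace {ρ A : Op ι} (hρ : IsState ρ) (hA : A.IsHermitian) :
    qfi ρ A ≤ 4 * (ρ * (A * A)).trace.re := by
  have := qfi_mixture_le (κ := Unit) (p := fun _ => 1) (σ := fun _ => ρ) (fun _ => zero_le_one)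
    (fun _ => hρ) hA
  simp only [Finset.univ_unique, Finset.sum_singleton, Complex.ofReal_one, one_smul, one_mul,
    variance] at this
  nlinarith [sq_nonneg (ρ * A).trace.re]

/-- For pure states the quantum Fisher information is four times the variance. -/
theorem qfi_pureState {ψ : ι → ℂ} (hψ : IsUnitVec ψ) {A : Op ι} (hA : A.IsHermitian) :
    qfi (pureState ψ) A = 4 * variance (pureState ψ) A := by
  set ρ := pureState ψ with hρd
  have hρ : ρ.IsHermitian := (posSemidef_pureState ψ).isHermitian
  obtain ⟨U, lam, hU, hU', hD, hq⟩ := exists_eigendecomposition hρ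
  set D : Op ι := Matrix.diagonal (fun k => (lam k : ℂ)) with hDd
  have hDρ : Uᴴ * ρ * U = D := by
    rw [hD]
    simp only [Matrix.mul_assoc, hU', Matrix.mul_one]
    rw [← Matrix.mul_assoc, hU', Matrix.one_mul]
  -- A rank-one projector is idempotent, hence so is its diagonal form.
  have hsq : ∀ k, lam k = 0 ∨ lam k = 1 := by
    intro k
    have h : D * D = D := by
      calc D * D = Uᴴ * ρ * (U * Uᴴ) * ρ * U := by
            rw [← hDρ]; simp only [Matrix.mul_assoc]
        _ = Uᴴ * (ρ * ρ) * U := by rw [hU, Matrix.mul_one]; simp only [Matrix.mul_assoc]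
        _ = D := by rw [pureState_mul_self hψ, hDρ]
    have h2 := congrFun (congrFun h k) k
    rw [hDd, Matrix.diagonal_mul_diagonal, Matrix.diagonal_apply_eq, Matrix.diagonal_apply_eq]
      at h2
    have h3 : lam k * lam k = lam k := by exact_mod_cast h2
    have h4 : lam k * (lam k - 1) = 0 := by linarith
    exact (mul_eq_zero.mp h4).imp_right fun h => by linarith
  have hBh : (Uᴴ * A * U).IsHermitian := Matrix.isHermitian_conjTranspose_mul_mul U hA
  have sw := mul_swap_of_isHermitian hBh
  have nsw : ∀ k l, ‖(Uᴴ * A * U) l k‖ = ‖(Uᴴ * A * U) k l‖ := fun k l => by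
    rw [← hBh.apply l k, norm_star]
  have e4 : Uᴴ * (ρ * A) * U = D * (Uᴴ * A * U) := by
    calc Uᴴ * (ρ * A) * U = Uᴴ * (ρ * 1 * A) * U := by rw [Matrix.mul_one]
      _ = _ := by rw [← hU, ← hDρ]; simp only [Matrix.mul_assoc]
  have e1 : (ρ * (A * A)).trace =
      ((∑ k, ∑ l, lam k * ‖(Uᴴ * A * U) k l‖ ^ 2 : ℝ) : ℂ) := by
    have := trace_mul_mul_eigenbasis (lam := lam) hU A A
    rw [← hD] at this
    rw [this]
    simp only [sw]
    push_cast
    rfl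
  have e2 : (ρ * (A * (ρ * A))).trace =
      ((∑ k, ∑ l, lam k * lam l * ‖(Uᴴ * A * U) k l‖ ^ 2 : ℝ) : ℂ) := by
    have := trace_mul_mul_eigenbasis (lam := lam) hU A (ρ * A)
    rw [← hD, e4] at this
    rw [this]
    push_cast
    refine Finset.sum_congr rfl fun k _ => Finset.sum_congr rfl fun l _ => ?_
    have := sw k l
    push_cast at this
    rw [hDd, Matrix.diagonal_mul, ← this]
    ring
  have e3 : (ρ * (A * (ρ * A))).trace = (ρ * A).trace ^ 2 := by
    rw [← Matrix.mul_assoc, ← Matrix.mul_assoc, hρd, pureState_mul_mul_pureState,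
      Matrix.smul_mul, Matrix.trace_smul, smul_eq_mul, sq]
  have e5 : (ρ * A).trace = ((ρ * A).trace.re : ℂ) := by
    apply Complex.ext <;> simp [trace_mul_im_eq_zero hρ hA]
  rw [e3, e5] at e2
  norm_cast at e2
  rw [variance, e1, Complex.ofReal_re, e2, hq]
  have e6 : (∑ k, ∑ l, lam k * ‖(Uᴴ * A * U) k l‖ ^ 2) =
      ∑ k, ∑ l, lam l * ‖(Uᴴ * A * U) k l‖ ^ 2 := by
    rw [Finset.sum_comm]
    simp only [nsw]
  have e7 : 4 * (∑ k, ∑ l, lam k * ‖(Uᴴ * A * U) k l‖ ^ 2) =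
      2 * ((∑ k, ∑ l, lam k * ‖(Uᴴ * A * U) k l‖ ^ 2) +
        ∑ k, ∑ l, lam l * ‖(Uᴴ * A * U) k l‖ ^ 2) := by
    rw [← e6]; ring
  rw [mul_sub, e7]
  simp only [Finset.mul_sum, ← Finset.sum_add_distrib, ← Finset.sum_sub_distrib]
  refine Finset.sum_congr rfl fun k _ => Finset.sum_congr rfl fun l _ => ?_
  -- On {0, 1} the coefficient (λ − μ)²/(λ + μ) equals λ + μ − 2λμ, including 0/0 = 0.
  rcases hsq k with h | h <;> rcases hsq l with h' | h' <;> rw [h, h'] <;> ring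

end QFI

/-! ### Tensor products of one-qubit operators -/

section Tensor

variable {N : ℕ}

lemma prod_sum_qubits {R : Type} [CommSemiring R] (f : Fin N → Fin 2 → R) :
    ∏ i, ∑ b, f i b = ∑ x : QIdx N, ∏ i, f i (x i) := by
  rw [Finset.prod_univ_sum, Fintype.piFinset_univ]

lemma tensorOp_mul (A B : Fin N → Op (Fin 2)) :
    tensorOp A * tensorOp B = tensorOp fun i => A i * B i := by
  ext x z
  simp only [Matrix.mul_apply, tensorOp, Matrix.of_apply, ← Finset.prod_mul_distrib]
  exact (prod_sum_qubits fun i b => A i (x i) b * B i b (z i)).symm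

lemma tensorOp_one : tensorOp (fun _ : Fin N => (1 : Op (Fin 2))) = 1 := by
  ext x y
  simp only [tensorOp, Matrix.of_apply, Matrix.one_apply, Finset.prod_ite_zero,
    Finset.prod_const_one, Finset.mem_univ, true_imp_iff, funext_iff]

lemma conjTranspose_tensorOp (A : Fin N → Op (Fin 2)) :
    (tensorOp A)ᴴ = tensorOp fun i => (A i)ᴴ := by
  ext x y
  simp [tensorOp, Matrix.conjTranspose_apply]

lemma trace_tensorOp (A : Fin N → Op (Fin 2)) : (tensorOp A).trace = ∏ i, (A i).trace := by
  simp only [Matrix.trace, Matrix.diag_apply, tensorOp, Matrix.of_apply]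
  exact (prod_sum_qubits fun i b => A i b b).symm

lemma pureState_tensorVec (φ : Fin N → Fin 2 → ℂ) :
    pureState (tensorVec φ) = tensorOp fun i => pureState (φ i) := by
  ext x y
  simp [pureState, tensorVec, tensorOp, Matrix.vecMulVec_apply, Finset.prod_mul_distrib]

lemma isUnitVec_tensorVec {φ : Fin N → Fin 2 → ℂ} (h : ∀ i, IsUnitVec (φ i)) :
    IsUnitVec (tensorVec φ) := by
  have h1 : (pureState (tensorVec φ)).trace = 1 := by
    rw [pureState_tensorVec, trace_tensorOp]
    exact Finset.prod_eq_one fun i _ => (isState_pureState (h i)).2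
  rwa [pureState, Matrix.trace_vecMulVec, dotProduct_comm] at h1

/-! ### One-qubit operators on a given site -/

lemma onSite_apply (i : Fin N) (A : Op (Fin 2)) (x y : QIdx N) :
    onSite i A x y = A (x i) (y i) * ∏ j ∈ Finset.univ.erase i, (1 : Op (Fin 2)) (x j) (y j) := by
  rw [onSite, tensorOp, Matrix.of_apply, ← Finset.mul_prod_erase _ _ (Finset.mem_univ i),
    Function.update_self]
  congr 1
  refine Finset.prod_congr rfl fun j hj => ?_
  rw [Function.update_of_ne (Finset.ne_of_mem_erase hj)]

lemma onSite_eq_zero {i : Fin N} {x y : QIdx N} (A : Op (Fin 2)) (h : ∃ j, j ≠ i ∧ x j ≠ y j) :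
    onSite i A x y = 0 := by
  obtain ⟨j, hj, hxy⟩ := h
  rw [onSite_apply, Finset.prod_eq_zero (Finset.mem_erase.mpr ⟨hj, Finset.mem_univ j⟩), mul_zero]
  exact Matrix.one_apply_ne hxy

lemma onSite_add (i : Fin N) (A B : Op (Fin 2)) :
    onSite i (A + B) = onSite i A + onSite i B := by
  ext x y
  simp only [Matrix.add_apply, onSite_apply, add_mul]

lemma onSite_smul (i : Fin N) (c : ℂ) (A : Op (Fin 2)) :
    onSite i (c • A) = c • onSite i A := by
  ext x y
  simp only [Matrix.smul_apply, onSite_apply, smul_eq_mul, mul_assoc]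

lemma onSite_sub (i : Fin N) (A B : Op (Fin 2)) :
    onSite i (A - B) = onSite i A - onSite i B := by
  ext x y
  simp only [Matrix.sub_apply, onSite_apply, sub_mul]

lemma onSite_sum {κ : Type} (i : Fin N) (s : Finset κ) (A : κ → Op (Fin 2)) :
    onSite i (∑ k ∈ s, A k) = ∑ k ∈ s, onSite i (A k) := by
  ext x y
  simp only [Matrix.sum_apply, onSite_apply, Finset.sum_mul]

lemma onSite_one (i : Fin N) : onSite i (1 : Op (Fin 2)) = 1 := by
  rw [onSite, ← tensorOp_one]
  congr 1
  exact Function.update_eq_self i _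

lemma tensorOp_mul_onSite (τ : Fin N → Op (Fin 2)) (i : Fin N) (A : Op (Fin 2)) :
    tensorOp τ * onSite i A = tensorOp (Function.update τ i (τ i * A)) := by
  rw [onSite, tensorOp_mul]
  congr 1
  ext j : 1
  rcases eq_or_ne j i with rfl | h
  · simp
  · simp [h]

lemma onSite_mul_tensorOp (τ : Fin N → Op (Fin 2)) (i : Fin N) (A : Op (Fin 2)) :
    onSite i A * tensorOp τ = tensorOp (Function.update τ i (A * τ i)) := by
  rw [onSite, tensorOp_mul]
  congr 1
  ext j : 1
  rcases eq_or_ne j i with rfl | h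
  · simp
  · simp [h]

lemma onSite_mul_self (i : Fin N) (A B : Op (Fin 2)) :
    onSite i A * onSite i B = onSite i (A * B) := by
  conv_lhs => rw [onSite, tensorOp_mul_onSite]
  simp [onSite]

lemma onSite_mul_comm {i j : Fin N} (h : i ≠ j) (A B : Op (Fin 2)) :
    onSite i A * onSite j B = onSite j B * onSite i A := by
  conv_lhs => rw [onSite, tensorOp_mul_onSite]
  conv_rhs => rw [onSite.eq_def i, onSite_mul_tensorOp]
  simp [Function.update_of_ne h.symm]

lemma conjTranspose_onSite (i : Fin N) (A : Op (Fin 2)) : (onSite i A)ᴴ = onSite i Aᴴ := by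
  rw [onSite, conjTranspose_tensorOp, onSite]
  congr 1
  ext j : 1
  rcases eq_or_ne j i with rfl | h
  · simp
  · simp [h]

lemma onSite_mulVec (i : Fin N) (A : Op (Fin 2)) (ψ : QIdx N → ℂ) (x : QIdx N) :
    (onSite i A *ᵥ ψ) x = ∑ b, A (x i) b * ψ (Function.update x i b) := by
  -- Only labels that agree with `x` off site `i` contribute, and these are the updates of `x` at
  -- `i`.
  refine (Fintype.sum_of_injective (Function.update x i) (Function.update_injective x i) _ _
    (fun y hy => ?_) fun b => ?_).symm
  · refine mul_eq_zero_of_left (onSite_eq_zero A ?_) _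
    by_contra! hcon
    refine hy ⟨y i, ?_⟩
    ext j : 1
    rcases eq_or_ne j i with rfl | h
    · simp
    · simp [h, hcon j h]
  · refine congrArg (· * ψ (Function.update x i b)) ?_
    simp only
    rw [onSite_apply, Function.update_self, Finset.prod_eq_one, mul_one]
    intro j hj
    rw [Function.update_of_ne (Finset.ne_of_mem_erase hj), Matrix.one_apply_eq]

end Tensor

/-! ### Pauli matrices and the collective spin -/

section Spin

variable {N : ℕ}

lemma pauliAlong_eq (n : EuclideanSpace ℝ (Fin 3)) :
    pauliAlong n = !![(n 2 : ℂ), n 0 - n 1 * Complex.I; n 0 + n 1 * Complex.I, -n 2] := by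
  rw [pauliAlong, Fin.sum_univ_three]
  ext i j
  fin_cases i <;> fin_cases j <;> simp [pauli] <;> ring

lemma isHermitian_pauliAlong (n : EuclideanSpace ℝ (Fin 3)) : (pauliAlong n).IsHermitian := by
  rw [pauliAlong_eq]
  ext i j
  fin_cases i <;> fin_cases j <;> simp [Matrix.conjTranspose_apply] <;> ring

lemma pauliAlong_single (a : Fin 3) : pauliAlong (EuclideanSpace.single a 1) = pauli a := by
  rw [pauliAlong, Finset.sum_eq_single a]
  · simp
  · intro b _ hb; simp [hb]
  · simp

lemma inner_eq_sum (m n : EuclideanSpace ℝ (Fin 3)) :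
    inner ℝ m n = m 0 * n 0 + m 1 * n 1 + m 2 * n 2 := by
  simp only [PiLp.inner_apply, Fin.sum_univ_three, RCLike.inner_apply, conj_trivial]
  ring

lemma sum_sq_eq_one {n : EuclideanSpace ℝ (Fin 3)} (hn : ‖n‖ = 1) :
    n 0 ^ 2 + n 1 ^ 2 + n 2 ^ 2 = 1 := by
  have := EuclideanSpace.real_norm_sq_eq n
  rw [hn, Fin.sum_univ_three] at this
  linarith

lemma pauliAlong_mul_add_mul (m n : EuclideanSpace ℝ (Fin 3)) :
    pauliAlong m * pauliAlong n + pauliAlong n * pauliAlong m =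
      ((2 * inner ℝ m n : ℝ) : ℂ) • 1 := by
  rw [pauliAlong_eq, pauliAlong_eq, PiLp.inner_apply, Fin.sum_univ_three]
  ext i j
  fin_cases i <;> fin_cases j <;> simp <;> ring_nf <;>
    simp only [Complex.I_sq] <;> ring

lemma pauliAlong_mul_self {n : EuclideanSpace ℝ (Fin 3)} (hn : ‖n‖ = 1) :
    pauliAlong n * pauliAlong n = 1 := by
  have h := pauliAlong_mul_add_mul n n
  rw [real_inner_self_eq_norm_sq, hn, ← two_smul ℂ] at h
  have h2 : (2 : ℂ) • (pauliAlong n * pauliAlong n) = (2 : ℂ) • 1 := by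
    rw [h]; norm_num
  exact smul_right_injective _ two_ne_zero h2

lemma collectiveSpin_eq (n : EuclideanSpace ℝ (Fin 3)) :
    collectiveSpin N n = (1 / 2 : ℂ) • ∑ i, onSite i (pauliAlong n) := by
  rw [collectiveSpin, Finset.smul_sum]
  exact Finset.sum_congr rfl fun i _ => onSite_smul _ _ _

lemma spinComponent_eq (a : Fin 3) :
    spinComponent N a = (1 / 2 : ℂ) • ∑ i, onSite i (pauli a) := by
  rw [spinComponent, collectiveSpin_eq, pauliAlong_single]

lemma collectiveSpin_eq_sum (n : EuclideanSpace ℝ (Fin 3)) :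
    collectiveSpin N n = ∑ a, (n a : ℂ) • spinComponent N a := by
  simp only [collectiveSpin_eq, spinComponent_eq, pauliAlong, onSite_sum, onSite_smul]
  rw [Finset.sum_comm, Finset.smul_sum]
  refine Finset.sum_congr rfl fun a _ => ?_
  rw [← Finset.smul_sum, smul_comm]

lemma isHermitian_collectiveSpin (n : EuclideanSpace ℝ (Fin 3)) :
    (collectiveSpin N n).IsHermitian := by
  rw [Matrix.IsHermitian, collectiveSpin_eq, Matrix.conjTranspose_smul, Matrix.conjTranspose_sum]
  congr 1
  · simp
  · refine Finset.sum_congr rfl fun i _ => ?_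
    rw [conjTranspose_onSite, (isHermitian_pauliAlong n).eq]

/-- The cross product on Euclidean three-space. -/
def cross (m n : EuclideanSpace ℝ (Fin 3)) : EuclideanSpace ℝ (Fin 3) :=
  !₂[m 1 * n 2 - m 2 * n 1, m 2 * n 0 - m 0 * n 2, m 0 * n 1 - m 1 * n 0]

lemma pauliAlong_commutator (m n : EuclideanSpace ℝ (Fin 3)) :
    pauliAlong m * pauliAlong n - pauliAlong n * pauliAlong m =
      (2 * Complex.I) • pauliAlong (cross m n) := by
  rw [pauliAlong_eq, pauliAlong_eq, pauliAlong_eq]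
  ext i j
  fin_cases i <;> fin_cases j <;> simp [cross] <;> ring_nf <;>
    simp only [Complex.I_sq] <;> ring

/-- Operators on distinct sites commute, so only the diagonal of the double sum survives. -/
lemma sum_onSite_commutator (A B : Op (Fin 2)) :
    (∑ i : Fin N, onSite i A) * (∑ i, onSite i B) - (∑ i, onSite i B) * (∑ i, onSite i A) =
      ∑ i, onSite i (A * B - B * A) := by
  rw [Finset.sum_mul_sum, Finset.sum_mul_sum, Finset.sum_comm (f := fun i j => onSite i B * _),
    ← Finset.sum_sub_distrib]
  refine Finset.sum_congr rfl fun i _ => ?_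
  rw [← Finset.sum_sub_distrib, Finset.sum_eq_single i]
  · rw [onSite_mul_self, onSite_mul_self, onSite_sub]
  · intro j _ hj
    rw [onSite_mul_comm hj.symm, sub_self]
  · simp

lemma collectiveSpin_commutator (m n : EuclideanSpace ℝ (Fin 3)) :
    collectiveSpin N m * collectiveSpin N n - collectiveSpin N n * collectiveSpin N m =
      Complex.I • collectiveSpin N (cross m n) := by
  rw [collectiveSpin_eq, collectiveSpin_eq, collectiveSpin_eq]
  simp only [Matrix.smul_mul, Matrix.mul_smul, ← smul_sub]
  rw [sum_onSite_commutator, pauliAlong_commutator]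
  simp only [onSite_smul, ← Finset.smul_sum, smul_smul]
  congr 1
  ring

/-! ### The total spin -/

/-- The squared total spin `L_x² + L_y² + L_z²`. -/
noncomputable def totalSpinSq (N : ℕ) : Op (QIdx N) :=
  ∑ a, spinComponent N a * spinComponent N a

/-- Entrywise form of ∑ₐ σₐ⊗σₐ = 2·SWAP − 1, which converts spin couplings into transpositions of
qubits. -/
lemma sum_pauli_mul_pauli (s t b c : Fin 2) :
    ∑ a, pauli a s b * pauli a t c =
      2 * (if c = s ∧ b = t then 1 else 0) - if b = s ∧ c = t then 1 else 0 := by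
  rw [Fin.sum_univ_three]
  fin_cases s <;> fin_cases t <;> fin_cases b <;> fin_cases c <;> simp [pauli] <;> norm_num

lemma sum_onSite_pauli_mulVec (i j : Fin N) (ψ : QIdx N → ℂ) (x : QIdx N) :
    ∑ a, ((onSite i (pauli a) * onSite j (pauli a)) *ᵥ ψ) x =
      2 * ψ (x ∘ Equiv.swap i j) - ψ x + if i = j then 2 * ψ x else 0 := by
  rcases eq_or_ne i j with rfl | h
  · have h1 : ∀ a, pauli a * pauli a = 1 := fun a => by
      rw [← pauliAlong_single, pauliAlong_mul_self (by simp)]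
    simp only [onSite_mul_self, h1, onSite_one, Matrix.one_mulVec, Finset.sum_const,
      Finset.card_univ, Fintype.card_fin, Equiv.swap_self, if_true]
    simp
    ring
  · simp only [← Matrix.mulVec_mulVec, onSite_mulVec, Function.update_of_ne h.symm, if_neg h,
      add_zero, Finset.mul_sum]
    rw [Finset.sum_comm]
    have h2 : ∀ b, ∑ a, ∑ c, pauli a (x i) b * (pauli a (x j) c *
          ψ (Function.update (Function.update x i b) j c)) =
        ∑ c, (2 * (if c = x i ∧ b = x j then 1 else 0) - if b = x i ∧ c = x j then 1 else 0) *
          ψ (Function.update (Function.update x i b) j c) := by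
      intro b
      rw [Finset.sum_comm]
      refine Finset.sum_congr rfl fun c _ => ?_
      rw [← sum_pauli_mul_pauli, Finset.sum_mul]
      exact Finset.sum_congr rfl fun a _ => by ring
    rw [Finset.sum_congr rfl fun b _ => h2 b]
    have h3 : Function.update (Function.update x i (x j)) j (x i) = x ∘ Equiv.swap i j := by
      rw [Equiv.comp_swap_eq_update, Function.update_comm h]
    simp only [sub_mul, Finset.sum_sub_distrib, mul_assoc, ← Finset.mul_sum, ite_and, ite_mul,
      one_mul, zero_mul]
    simp [h3]

/-- Each ordered pair i ≠ j contributes (2·SWAP − 1)/4. A diagonal pair contributes 3/4, which is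
the same expression with trivial swap plus 1/2; this excess sums to the N/2 in the constant. -/
lemma totalSpinSq_mulVec (ψ : QIdx N → ℂ) (x : QIdx N) :
    (totalSpinSq N *ᵥ ψ) x =
      (1 / 2) * (∑ i, ∑ j, ψ (x ∘ Equiv.swap i j)) + (2 * N - N ^ 2) / 4 * ψ x := by
  have h : totalSpinSq N = (1 / 4 : ℂ) • ∑ i, ∑ j, ∑ a,
      onSite i (pauli a) * onSite j (pauli a) := by
    rw [totalSpinSq]
    simp only [spinComponent_eq, Matrix.smul_mul, Matrix.mul_smul, smul_smul, Finset.sum_mul_sum]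
    rw [← Finset.smul_sum, Finset.sum_comm]
    congr 1
    · norm_num
    · exact Finset.sum_congr rfl fun i _ => Finset.sum_comm
  rw [h, Matrix.smul_mulVec, Pi.smul_apply]
  simp only [Matrix.sum_mulVec, Finset.sum_apply, sum_onSite_pauli_mulVec,
    Finset.sum_add_distrib, Finset.sum_sub_distrib, ← Finset.mul_sum, Finset.sum_ite_eq,
    Finset.sum_const, Finset.card_univ, Fintype.card_fin, smul_eq_mul, nsmul_eq_mul,
    Finset.mem_univ, if_true]
  ring

lemma totalSpinSq_mulVec_of_symmetric {ψ : QIdx N → ℂ} (h : IsSymmetricVec ψ) :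
    totalSpinSq N *ᵥ ψ = ((N * (N + 2) / 4 : ℝ) : ℂ) • ψ := by
  ext x
  rw [totalSpinSq_mulVec]
  simp only [h (Equiv.swap _ _) x, Finset.sum_const, Finset.card_univ, Fintype.card_fin,
    nsmul_eq_mul, Pi.smul_apply, smul_eq_mul]
  push_cast
  ring

/-- Permuting qubits preserves the norm, so the arithmetic–geometric mean inequality applies
termwise. -/
lemma re_dotProduct_permute_le (ψ : QIdx N → ℂ) (π : Equiv.Perm (Fin N)) :
    (star ψ ⬝ᵥ fun x => ψ (x ∘ π)).re ≤ (star ψ ⬝ᵥ ψ).re := by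
  have h1 : ∑ x : QIdx N, ‖ψ (x ∘ π)‖ ^ 2 = ∑ x, ‖ψ x‖ ^ 2 :=
    Equiv.sum_comp (Equiv.arrowCongr π.symm (Equiv.refl (Fin 2))) (fun x => ‖ψ x‖ ^ 2)
  have h2 : (star ψ ⬝ᵥ ψ).re = ∑ x, ‖ψ x‖ ^ 2 := by
    simp only [dotProduct, Complex.re_sum, Pi.star_apply, Complex.star_def]
    refine Finset.sum_congr rfl fun x _ => ?_
    rw [Complex.conj_mul']
    norm_cast
  have h3 : (star ψ ⬝ᵥ ψ).re = ∑ x : QIdx N, (‖ψ x‖ ^ 2 + ‖ψ (x ∘ π)‖ ^ 2) / 2 := by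
    rw [← Finset.sum_div, Finset.sum_add_distrib, h1, h2]
    ring
  rw [h3]
  simp only [dotProduct, Complex.re_sum, Pi.star_apply]
  refine Finset.sum_le_sum fun x _ => ?_
  calc _ ≤ ‖star (ψ x) * ψ (x ∘ π)‖ := Complex.re_le_norm _
    _ = ‖ψ x‖ * ‖ψ (x ∘ π)‖ := by rw [norm_mul, norm_star]
    _ ≤ _ := by nlinarith [sq_nonneg (‖ψ x‖ - ‖ψ (x ∘ π)‖)]

/-- The total spin is at most `N/2`. -/
theorem trace_mul_totalSpinSq_le {ρ : Op (QIdx N)} (hρ : IsState ρ) :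
    (ρ * totalSpinSq N).trace.re ≤ N * (N + 2) / 4 := by
  -- Bounding each of the N² swap terms by the identity gives N²/2 + (2N − N²)/4 = N(N+2)/4.
  have h := trace_mul_nonneg_of_forall hρ.1
    (A := ((N * (N + 2) / 4 : ℝ) : ℂ) • 1 - totalSpinSq N) fun v => by
      have e : totalSpinSq N *ᵥ v = (1 / 2 : ℂ) • (∑ i, ∑ j, fun x => v (x ∘ Equiv.swap i j)) +
          (((2 * N - N ^ 2) / 4 : ℝ) : ℂ) • v := by
        ext x
        rw [totalSpinSq_mulVec]
        simp
      have h2 : (1 / 2 : ℂ) = ((1 / 2 : ℝ) : ℂ) := by push_cast; rfl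
      rw [Matrix.sub_mulVec, Matrix.smul_mulVec, Matrix.one_mulVec, e, dotProduct_sub,
        dotProduct_add, dotProduct_smul, dotProduct_smul, dotProduct_smul, h2]
      simp only [dotProduct_sum, smul_eq_mul, Complex.sub_re, Complex.add_re,
        Complex.re_ofReal_mul, Complex.re_sum]
      have h3 : ∑ i, ∑ j, (star v ⬝ᵥ fun x => v (x ∘ Equiv.swap i j)).re ≤
          ∑ i : Fin N, ∑ j : Fin N, (star v ⬝ᵥ v).re :=
        Finset.sum_le_sum fun i _ => Finset.sum_le_sum fun j _ => re_dotProduct_permute_le v _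
      simp only [Finset.sum_const, Finset.card_univ, Fintype.card_fin, nsmul_eq_mul] at h3
      linarith
  rw [Matrix.mul_sub, Matrix.mul_smul, Matrix.mul_one, Matrix.trace_sub, Matrix.trace_smul,
    hρ.2, Complex.sub_re, smul_eq_mul, Complex.re_ofReal_mul, Complex.one_re] at h
  linarith

/-! ### Orthonormal frames -/

/-- Completeness relation of an orthonormal frame. -/
lemma frame_sum {R : Fin 3 → EuclideanSpace ℝ (Fin 3)} (hR : Orthonormal ℝ R) (a b : Fin 3) :
    ∑ k, R k a * R k b = if a = b then 1 else 0 := by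
  set M : Matrix (Fin 3) (Fin 3) ℝ := Matrix.of fun k a => R k a with hM
  have h1 : M * Mᵀ = 1 := by
    ext k l
    rw [Matrix.mul_apply, Matrix.one_apply, ← orthonormal_iff_ite.mp hR k l, PiLp.inner_apply]
    exact Finset.sum_congr rfl fun a _ => mul_comm _ _
  have h2 : Mᵀ * M = 1 := mul_eq_one_comm.mp h1
  have h3 := congrFun (congrFun h2 a) b
  rwa [Matrix.mul_apply, Matrix.one_apply] at h3

/-- The Casimir operator is the same in every frame, so the frame can be adapted to ν. -/
lemma sum_collectiveSpin_sq {R : Fin 3 → EuclideanSpace ℝ (Fin 3)} (hR : Orthonormal ℝ R) :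
    ∑ k, collectiveSpin N (R k) * collectiveSpin N (R k) = totalSpinSq N := by
  have h1 : ∀ n : EuclideanSpace ℝ (Fin 3), collectiveSpin N n * collectiveSpin N n =
      ∑ a, ∑ b, ((n a * n b : ℝ) : ℂ) • (spinComponent N a * spinComponent N b) := fun n => by
    rw [collectiveSpin_eq_sum, Finset.sum_mul_sum]
    refine Finset.sum_congr rfl fun a _ => Finset.sum_congr rfl fun b _ => ?_
    rw [Matrix.smul_mul, Matrix.mul_smul, smul_smul, Complex.ofReal_mul]
  rw [Finset.sum_congr rfl fun k _ => h1 (R k), Finset.sum_comm, totalSpinSq]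
  refine Finset.sum_congr rfl fun a _ => ?_
  rw [Finset.sum_comm, Finset.sum_eq_single a]
  · rw [← Finset.sum_smul, ← Complex.ofReal_sum, frame_sum hR, if_pos rfl, Complex.ofReal_one,
      one_smul]
  · intro b _ hb
    rw [← Finset.sum_smul, ← Complex.ofReal_sum, frame_sum hR, if_neg hb.symm, Complex.ofReal_zero,
      zero_smul]
  · simp

lemma orthonormal_frame {n ν : EuclideanSpace ℝ (Fin 3)} (hn : ‖n‖ = 1) (hν : ‖ν‖ = 1)
    (h : inner ℝ ν n = 0) : Orthonormal ℝ ![n, cross ν n, ν] := by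
  have hn2 := sum_sq_eq_one hn
  have hν2 := sum_sq_eq_one hν
  rw [inner_eq_sum] at h
  rw [orthonormal_iff_ite]
  intro i j
  rw [inner_eq_sum]
  fin_cases i <;> fin_cases j <;> simp [cross]
  · linear_combination hn2
  · ring
  · linear_combination h
  · ring
  -- Lagrange's identity |ν×n|² = |ν|²|n|² − (ν·n)².
  · linear_combination hn2 + (n 0 ^ 2 + n 1 ^ 2 + n 2 ^ 2) * hν2 -
      (ν 0 * n 0 + ν 1 * n 1 + ν 2 * n 2) * h
  · ring
  · linear_combination h
  · ring
  · linear_combination hν2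

lemma cross_cross {n ν : EuclideanSpace ℝ (Fin 3)} (hν : ‖ν‖ = 1) (h : inner ℝ ν n = 0) :
    cross ν (cross ν n) = -n := by
  have hν2 := sum_sq_eq_one hν
  rw [inner_eq_sum] at h
  ext i
  fin_cases i <;> simp [cross]
  · linear_combination ν 0 * h - n 0 * hν2
  · linear_combination ν 1 * h - n 1 * hν2
  · linear_combination ν 2 * h - n 2 * hν2

lemma exists_mem_planeAxes (ν : EuclideanSpace ℝ (Fin 3)) : (planeAxes ν).Nonempty := by
  by_cases h : ν 0 = 0 ∧ ν 1 = 0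
  · refine ⟨EuclideanSpace.single 0 1, by simp, ?_⟩
    simp [PiLp.inner_apply, h.1]
  · set v : EuclideanSpace ℝ (Fin 3) := !₂[-ν 1, ν 0, 0] with hv
    have hv0 : v ≠ 0 := by
      intro h0
      refine h ⟨?_, ?_⟩
      · have := congrArg (fun w => w 1) h0
        simpa [hv] using this
      · have := congrArg (fun w => w 0) h0
        simpa [hv] using this
    refine ⟨‖v‖⁻¹ • v, norm_smul_inv_norm hv0, ?_⟩
    rw [inner_smul_right, inner_eq_sum]
    simp [hv]
    right
    ring

end Spin

/-! ### Worst-case sensitivities -/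

section WorstCase

variable {N : ℕ}

lemma continuous_collectiveSpin : Continuous (collectiveSpin N) := by
  have h : collectiveSpin N = fun n => ∑ a, (n a : ℂ) • spinComponent N a :=
    funext collectiveSpin_eq_sum
  rw [h]
  refine continuous_finsetSum _ fun a _ => Continuous.fun_smul ?_ continuous_const
  fun_prop

/-- The spectral data of ρ stay fixed; the axis enters only through the matrix elements of L_n,
which are linear in n. -/
lemma continuous_qfi_collectiveSpin {ρ : Op (QIdx N)} (hρ : ρ.IsHermitian) :
    Continuous fun n => qfi ρ (collectiveSpin N n) := by
  obtain ⟨U, lam, -, -, -, hq⟩ := exists_eigendecomposition hρ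
  simp only [hq]
  refine continuous_const.mul (continuous_finsetSum _ fun k _ => continuous_finsetSum _ fun l _ =>
    continuous_const.mul (Continuous.pow (Continuous.norm ?_) 2))
  exact ((continuous_const.matrix_mul continuous_collectiveSpin).matrix_mul
    continuous_const).matrix_elem k l

lemma isCompact_allAxes : IsCompact allAxes := by
  have h : allAxes = Metric.sphere 0 1 := by ext; simp [allAxes]
  rw [h]
  exact isCompact_sphere _ _

lemma isCompact_planeAxes (ν : EuclideanSpace ℝ (Fin 3)) : IsCompact (planeAxes ν) := by
  have h : planeAxes ν = allAxes ∩ {n | inner ℝ ν n = 0} := rfl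
  rw [h]
  exact isCompact_allAxes.inter_right (isClosed_eq (by fun_prop) continuous_const)

lemma nonempty_allAxes : allAxes.Nonempty :=
  (exists_mem_planeAxes 0).mono fun _ h => h.1

/-- A continuous function on a nonempty compact set attains its infimum; this makes the `sInf` in
`worstCase` a genuine minimum. -/
lemma isLeast_worstCase {Ω : Set (EuclideanSpace ℝ (Fin 3))} (hΩ : IsCompact Ω)
    (hne : Ω.Nonempty) {ρ : Op (QIdx N)} (hρ : IsState ρ) :
    IsLeast (sensitivities Ω ρ) (worstCase Ω ρ) :=
  (hΩ.image (continuous_qfi_collectiveSpin hρ.1.isHermitian)).isLeast_sInf (hne.image _)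

lemma worstCase_eq_of_forall {Ω : Set (EuclideanSpace ℝ (Fin 3))} (hne : Ω.Nonempty)
    {ρ : Op (QIdx N)} {v : ℝ} (h : ∀ n ∈ Ω, qfi ρ (collectiveSpin N n) = v) :
    worstCase Ω ρ = v := by
  have : sensitivities Ω ρ = {v} := by
    rw [sensitivities, Set.image_congr h, hne.image_const]
  rw [worstCase, this, csInf_singleton]

lemma worstCase_planeAxes_le {ν n : EuclideanSpace ℝ (Fin 3)} (hn : n ∈ planeAxes ν)
    {ρ : Op (QIdx N)} (hρ : IsState ρ) :
    worstCase (planeAxes ν) ρ ≤ qfi ρ (collectiveSpin N n) :=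
  (isLeast_worstCase (isCompact_planeAxes ν) (exists_mem_planeAxes ν) hρ).2 ⟨n, hn, rfl⟩

lemma worstCase_allAxes_le {n : EuclideanSpace ℝ (Fin 3)} (hn : ‖n‖ = 1)
    {ρ : Op (QIdx N)} (hρ : IsState ρ) :
    worstCase allAxes ρ ≤ qfi ρ (collectiveSpin N n) :=
  (isLeast_worstCase isCompact_allAxes nonempty_allAxes hρ).2 ⟨n, hn, rfl⟩

lemma cross_mem_planeAxes {n ν : EuclideanSpace ℝ (Fin 3)} (hν : ‖ν‖ = 1)
    (hn : n ∈ planeAxes ν) : cross ν n ∈ planeAxes ν := by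
  have h := orthonormal_frame hn.1 hν hn.2
  exact ⟨h.1 1, h.2 (i := 2) (j := 1) (by decide)⟩

/-- The worst case in a plane is at most the average over two orthogonal directions. -/
lemma two_mul_worstCase_planeAxes_le {ν n : EuclideanSpace ℝ (Fin 3)} (hν : ‖ν‖ = 1)
    (hn : n ∈ planeAxes ν) {ρ : Op (QIdx N)} (hρ : IsState ρ) :
    2 * worstCase (planeAxes ν) ρ ≤
      qfi ρ (collectiveSpin N n) + qfi ρ (collectiveSpin N (cross ν n)) := by
  have h1 := worstCase_planeAxes_le hn hρ
  have h2 := worstCase_planeAxes_le (cross_mem_planeAxes hν hn) hρ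
  linarith

/-- The worst case is at most the average over an orthonormal frame. -/
lemma three_mul_worstCase_allAxes_le {R : Fin 3 → EuclideanSpace ℝ (Fin 3)}
    (hR : Orthonormal ℝ R) {ρ : Op (QIdx N)} (hρ : IsState ρ) :
    3 * worstCase allAxes ρ ≤ ∑ k, qfi ρ (collectiveSpin N (R k)) := by
  rw [Fin.sum_univ_three]
  have h1 := worstCase_allAxes_le (hR.1 0) hρ
  have h2 := worstCase_allAxes_le (hR.1 1) hρ
  have h3 := worstCase_allAxes_le (hR.1 2) hρ
  linarith

lemma orthonormal_single : Orthonormal ℝ fun a : Fin 3 => EuclideanSpace.single a (1 : ℝ) := by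
  have h := (EuclideanSpace.basisFun (Fin 3) ℝ).orthonormal
  have e : ⇑(EuclideanSpace.basisFun (Fin 3) ℝ) = fun a => EuclideanSpace.single a (1 : ℝ) :=
    funext fun a => EuclideanSpace.basisFun_apply _ _ a
  rwa [e] at h

lemma trace_mul_collectiveSpin_sq_nonneg {ρ : Op (QIdx N)} (hρ : ρ.PosSemidef)
    (n : EuclideanSpace ℝ (Fin 3)) :
    0 ≤ (ρ * (collectiveSpin N n * collectiveSpin N n)).trace.re := by
  have := trace_mul_conjTranspose_mul_self_nonneg hρ (collectiveSpin N n)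
  rwa [(isHermitian_collectiveSpin n).eq] at this

lemma sum_trace_mul_collectiveSpin_sq {R : Fin 3 → EuclideanSpace ℝ (Fin 3)}
    (hR : Orthonormal ℝ R) (ρ : Op (QIdx N)) :
    ∑ k, (ρ * (collectiveSpin N (R k) * collectiveSpin N (R k))).trace.re =
      (ρ * totalSpinSq N).trace.re := by
  rw [← sum_collectiveSpin_sq hR, Finset.mul_sum, Matrix.trace_sum, Complex.re_sum]

/-- The two in-plane second moments sum to the Casimir expectation minus ⟨L_ν²⟩ ≥ 0. -/
theorem worstCase_planeAxes_le_of_isState {ν : EuclideanSpace ℝ (Fin 3)} (hν : ‖ν‖ = 1)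
    {ρ : Op (QIdx N)} (hρ : IsState ρ) :
    worstCase (planeAxes ν) ρ ≤ (N : ℝ) * (N + 2) / 2 := by
  obtain ⟨n, hn⟩ := exists_mem_planeAxes ν
  have h1 := two_mul_worstCase_planeAxes_le hν hn hρ
  have h2 := sum_trace_mul_collectiveSpin_sq (orthonormal_frame hn.1 hν hn.2) ρ
  rw [Fin.sum_univ_three] at h2
  simp only [Matrix.cons_val] at h2
  have h3 := trace_mul_totalSpinSq_le hρ
  have h4 := trace_mul_collectiveSpin_sq_nonneg hρ.1 ν
  have h5 := qfi_le_four_mul_trace hρ (isHermitian_collectiveSpin n)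
  have h6 := qfi_le_four_mul_trace hρ (isHermitian_collectiveSpin (cross ν n))
  linarith

theorem worstCase_allAxes_le_of_isState {ρ : Op (QIdx N)} (hρ : IsState ρ) :
    worstCase allAxes ρ ≤ (N : ℝ) * (N + 2) / 3 := by
  have h1 := three_mul_worstCase_allAxes_le orthonormal_single hρ
  have h2 := sum_trace_mul_collectiveSpin_sq orthonormal_single ρ
  have h3 := trace_mul_totalSpinSq_le hρ
  have h4 : ∑ k, qfi ρ (collectiveSpin N (EuclideanSpace.single k (1 : ℝ))) ≤
      ∑ k, 4 * (ρ * (collectiveSpin N (EuclideanSpace.single k (1 : ℝ)) *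
        collectiveSpin N (EuclideanSpace.single k (1 : ℝ)))).trace.re :=
    Finset.sum_le_sum fun k _ => qfi_le_four_mul_trace hρ (isHermitian_collectiveSpin _)
  rw [← Finset.mul_sum, h2] at h4
  linarith

/-- Exhibiting a greatest element also rules out a default value of `sSup`. -/
lemma limitAttained_of_le {R : Set (Op (QIdx N))} {Ω : Set (EuclideanSpace ℝ (Fin 3))} {v : ℝ}
    (hle : ∀ ρ ∈ R, worstCase Ω ρ ≤ v) {ρ : Op (QIdx N)} (hρ : ρ ∈ R) (h : worstCase Ω ρ = v) :
    LimitAttained R Ω v := by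
  have hg : IsGreatest (worstCase Ω '' R) v := by
    refine ⟨⟨ρ, hρ, h⟩, ?_⟩
    rintro _ ⟨σ, hσ, rfl⟩
    exact hle σ hσ
  exact ⟨hg.csSup_eq, hg⟩

end WorstCase

/-! ### Product states -/

section Product

variable {N : ℕ}

lemma trace_tensorOp_update {τ : Fin N → Op (Fin 2)} (hτ : ∀ i, (τ i).trace = 1) (i : Fin N)
    (A : Op (Fin 2)) : (tensorOp (Function.update τ i A)).trace = A.trace := by
  rw [trace_tensorOp, ← Finset.mul_prod_erase _ _ (Finset.mem_univ i), Function.update_self,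
    Finset.prod_eq_one, mul_one]
  intro j hj
  rw [Function.update_of_ne (Finset.ne_of_mem_erase hj), hτ]

lemma trace_tensorOp_mul_onSite {τ : Fin N → Op (Fin 2)} (hτ : ∀ i, (τ i).trace = 1) (i : Fin N)
    (A : Op (Fin 2)) : (tensorOp τ * onSite i A).trace = (τ i * A).trace := by
  rw [tensorOp_mul_onSite, trace_tensorOp_update hτ]

lemma trace_tensorOp_mul_onSite_mul_onSite {τ : Fin N → Op (Fin 2)} (hτ : ∀ i, (τ i).trace = 1)
    {i j : Fin N} (h : i ≠ j) (A B : Op (Fin 2)) :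
    (tensorOp τ * (onSite i A * onSite j B)).trace = (τ i * A).trace * (τ j * B).trace := by
  rw [← Matrix.mul_assoc, tensorOp_mul_onSite, tensorOp_mul_onSite, trace_tensorOp,
    ← Finset.mul_prod_erase _ _ (Finset.mem_univ j),
    ← Finset.mul_prod_erase _ _ (Finset.mem_erase.mpr ⟨h, Finset.mem_univ i⟩),
    Finset.prod_eq_one, mul_one, Function.update_self, Function.update_of_ne h.symm,
    Function.update_of_ne h, Function.update_self, mul_comm]
  intro k hk
  rw [Finset.mem_erase, Finset.mem_erase] at hk
  rw [Function.update_of_ne hk.2.1, Function.update_of_ne hk.1, hτ]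

/-- Variances of collective spins add up in product states. -/
lemma variance_tensorOp {τ : Fin N → Op (Fin 2)} (hτ : ∀ i, IsState (τ i))
    {n : EuclideanSpace ℝ (Fin 3)} (hn : ‖n‖ = 1) :
    variance (tensorOp τ) (collectiveSpin N n) =
      (1 / 4) * ∑ i, (1 - (τ i * pauliAlong n).trace.re ^ 2) := by
  have hb : ∀ i, (τ i * pauliAlong n).trace = ((τ i * pauliAlong n).trace.re : ℂ) := fun i => by
    apply Complex.ext
    · simp
    · simp [trace_mul_im_eq_zero (hτ i).1.isHermitian (isHermitian_pauliAlong n)]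
  generalize hβ : (fun i => (τ i * pauliAlong n).trace.re) = β at *
  have hb' : ∀ i, (τ i * pauliAlong n).trace = (β i : ℂ) := fun i => by rw [hb, ← hβ]
  have h1 : (tensorOp τ * collectiveSpin N n).trace = ((1 / 2 * ∑ i, β i : ℝ) : ℂ) := by
    rw [collectiveSpin_eq, Matrix.mul_smul, Matrix.trace_smul, Finset.mul_sum, Matrix.trace_sum]
    simp only [trace_tensorOp_mul_onSite fun i => (hτ i).2, hb']
    push_cast
    rfl
  -- Off-diagonal correlations factorize. On the diagonal σₙ² = 1 replaces β² by 1, which leaves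
  -- exactly the one-qubit variances after the squared mean is subtracted.
  have h2 : (tensorOp τ * (collectiveSpin N n * collectiveSpin N n)).trace =
      ((1 / 4 * ∑ i, ∑ j, (β i * β j + if i = j then 1 - β i ^ 2 else 0) : ℝ) : ℂ) := by
    have e : collectiveSpin N n * collectiveSpin N n =
        (1 / 2 * (1 / 2) : ℂ) • ∑ i, ∑ j, onSite i (pauliAlong n) * onSite j (pauliAlong n) := by
      rw [collectiveSpin_eq, Matrix.smul_mul, Matrix.mul_smul, smul_smul, Finset.sum_mul_sum]
    rw [e, Matrix.mul_smul, Matrix.trace_smul, Finset.mul_sum, Matrix.trace_sum, smul_eq_mul]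
    push_cast
    congr 1
    · norm_num
    refine Finset.sum_congr rfl fun i _ => ?_
    rw [Finset.mul_sum, Matrix.trace_sum]
    refine Finset.sum_congr rfl fun j _ => ?_
    split_ifs with h
    · subst h
      rw [onSite_mul_self, pauliAlong_mul_self hn, trace_tensorOp_mul_onSite fun i => (hτ i).2,
        Matrix.mul_one, (hτ i).2]
      push_cast
      ring
    · rw [trace_tensorOp_mul_onSite_mul_onSite (fun i => (hτ i).2) h, hb', hb',
        Complex.ofReal_zero, add_zero]
  rw [variance, h1, h2, Complex.ofReal_re, Complex.ofReal_re]
  simp only [Finset.sum_add_distrib, Finset.sum_ite_eq, Finset.mem_univ, if_true,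
    ← Finset.mul_sum, ← Finset.sum_mul, ← hβ]
  ring

/-- The Bloch vector of a one-qubit vector. -/
noncomputable def bloch (φ : Fin 2 → ℂ) : EuclideanSpace ℝ (Fin 3) :=
  !₂[2 * ((φ 0).re * (φ 1).re + (φ 0).im * (φ 1).im),
    2 * ((φ 0).re * (φ 1).im - (φ 0).im * (φ 1).re),
    (φ 0).re ^ 2 + (φ 0).im ^ 2 - (φ 1).re ^ 2 - (φ 1).im ^ 2]

lemma trace_pureState_mul_pauliAlong (φ : Fin 2 → ℂ) (n : EuclideanSpace ℝ (Fin 3)) :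
    (pureState φ * pauliAlong n).trace.re = inner ℝ (bloch φ) n := by
  rw [pauliAlong_eq, inner_eq_sum]
  simp [pureState, Matrix.trace_fin_two, Matrix.mul_apply, Fin.sum_univ_two,
    Matrix.vecMulVec_apply, bloch]
  ring

lemma norm_bloch {φ : Fin 2 → ℂ} (h : IsUnitVec φ) : ‖bloch φ‖ = 1 := by
  have h1 : (φ 0).re ^ 2 + (φ 0).im ^ 2 + (φ 1).re ^ 2 + (φ 1).im ^ 2 = 1 := by
    have := congrArg Complex.re h
    simp [dotProduct, Fin.sum_univ_two] at this
    linarith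
  have h2 : ‖bloch φ‖ ^ 2 = 1 := by
    rw [EuclideanSpace.real_norm_sq_eq, Fin.sum_univ_three]
    simp [bloch]
    -- The squared Bloch length is s² with s = |φ₀|² + |φ₁|², and s² − 1 = (s + 1)(s − 1).
    linear_combination ((φ 0).re ^ 2 + (φ 0).im ^ 2 + (φ 1).re ^ 2 + (φ 1).im ^ 2 + 1) * h1
  nlinarith [norm_nonneg (bloch φ)]

lemma sum_inner_frame_sq {R : Fin 3 → EuclideanSpace ℝ (Fin 3)} (hR : Orthonormal ℝ R)
    {r : EuclideanSpace ℝ (Fin 3)} (hr : ‖r‖ = 1) : ∑ k, inner ℝ r (R k) ^ 2 = 1 := by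
  have h := fun a b => frame_sum hR a b
  have h00 := h 0 0
  have h01 := h 0 1
  have h02 := h 0 2
  have h11 := h 1 1
  have h12 := h 1 2
  have h22 := h 2 2
  simp [Fin.sum_univ_three] at h00 h01 h02 h11 h12 h22
  simp only [inner_eq_sum, Fin.sum_univ_three]
  linear_combination r 0 ^ 2 * h00 + r 1 ^ 2 * h11 + r 2 ^ 2 * h22 + 2 * r 0 * r 1 * h01 +
    2 * r 0 * r 2 * h02 + 2 * r 1 * r 2 * h12 + sum_sq_eq_one hr

lemma variance_tensorVec {φ : Fin N → Fin 2 → ℂ} (hφ : ∀ i, IsUnitVec (φ i))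
    {n : EuclideanSpace ℝ (Fin 3)} (hn : ‖n‖ = 1) :
    variance (pureState (tensorVec φ)) (collectiveSpin N n) =
      (1 / 4) * ∑ i, (1 - inner ℝ (bloch (φ i)) n ^ 2) := by
  rw [pureState_tensorVec, variance_tensorOp (fun i => isState_pureState (hφ i)) hn]
  simp only [trace_pureState_mul_pauliAlong]

/-- By Parseval for its unit Bloch vector, each qubit contributes (3 − 1)/4 = 1/2. -/
lemma sum_variance_tensorVec {R : Fin 3 → EuclideanSpace ℝ (Fin 3)} (hR : Orthonormal ℝ R)
    {φ : Fin N → Fin 2 → ℂ} (hφ : ∀ i, IsUnitVec (φ i)) :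
    ∑ k, variance (pureState (tensorVec φ)) (collectiveSpin N (R k)) = N / 2 := by
  rw [Finset.sum_congr rfl fun k _ => variance_tensorVec hφ (hR.1 k), ← Finset.mul_sum,
    Finset.sum_comm]
  have : ∀ i, ∑ k, (1 - inner ℝ (bloch (φ i)) (R k) ^ 2) = 2 := fun i => by
    rw [Finset.sum_sub_distrib, sum_inner_frame_sq hR (norm_bloch (hφ i))]
    norm_num
  simp only [this, Finset.sum_const, Finset.card_univ, Fintype.card_fin, nsmul_eq_mul]
  ring

lemma variance_add_variance_tensorVec_le {n ν : EuclideanSpace ℝ (Fin 3)} (hν : ‖ν‖ = 1)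
    (hn : n ∈ planeAxes ν) {φ : Fin N → Fin 2 → ℂ} (hφ : ∀ i, IsUnitVec (φ i)) :
    variance (pureState (tensorVec φ)) (collectiveSpin N n) +
      variance (pureState (tensorVec φ)) (collectiveSpin N (cross ν n)) ≤ N / 2 := by
  have h := sum_variance_tensorVec (orthonormal_frame hn.1 hν hn.2) hφ
  rw [Fin.sum_univ_three] at h
  simp only [Matrix.cons_val] at h
  have h2 : 0 ≤ variance (pureState (tensorVec φ)) (collectiveSpin N ν) := by
    rw [variance_tensorVec hφ hν]
    refine mul_nonneg (by norm_num) (Finset.sum_nonneg fun i _ => ?_)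
    have h3 := abs_real_inner_le_norm (bloch (φ i)) ν
    rw [norm_bloch (hφ i), hν, one_mul] at h3
    have := (sq_le_one_iff_abs_le_one _).mpr h3
    linarith
  linarith

/-! ### Separable states -/

/-- Every state is a mixture of pure states. -/
lemma exists_pure_decomposition {ι : Type} [Fintype ι] [DecidableEq ι] {τ : Op ι}
    (h : IsState τ) :
    ∃ (μ : ι → ℝ) (φ : ι → ι → ℂ), (∀ k, 0 ≤ μ k) ∧ ∑ k, μ k = 1 ∧ (∀ k, IsUnitVec (φ k)) ∧
      τ = ∑ k, (μ k : ℂ) • pureState (φ k) := by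
  obtain ⟨U, lam, hU, hU', hD, -⟩ := exists_eigendecomposition h.1.isHermitian
  have hu : ∀ k, IsUnitVec fun i => U i k := fun k => by
    have := congrFun (congrFun hU' k) k
    rwa [Matrix.mul_apply, Matrix.one_apply_eq] at this
  have hτ : τ = ∑ k, (lam k : ℂ) • pureState fun i => U i k := by
    rw [hD]
    ext i j
    rw [Matrix.mul_apply, Matrix.sum_apply]
    refine Finset.sum_congr rfl fun k _ => ?_
    rw [Matrix.mul_diagonal]
    simp [pureState, Matrix.vecMulVec_apply]
    ring
  refine ⟨lam, fun k i => U i k, fun k => ?_, ?_, hu, hτ⟩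
  · have h1 : Uᴴ * τ * U = Matrix.diagonal (fun k => (lam k : ℂ)) := by
      rw [hD]
      simp only [Matrix.mul_assoc, hU', Matrix.mul_one]
      rw [← Matrix.mul_assoc, hU', Matrix.one_mul]
    have h2 := (h.1.conjTranspose_mul_mul_same U).diag_nonneg (i := k)
    rw [h1, Matrix.diagonal_apply_eq] at h2
    exact_mod_cast h2
  · have h1 := congrArg Matrix.trace hτ
    rw [h.2, Matrix.trace_sum] at h1
    simp only [Matrix.trace_smul, (isState_pureState (hu _)).2, smul_eq_mul, mul_one] at h1
    exact_mod_cast h1.symm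

lemma tensorOp_sum (c : Fin N → Fin 2 → ℂ) (P : Fin N → Fin 2 → Op (Fin 2)) :
    tensorOp (fun i => ∑ b, c i b • P i b) =
      ∑ x : QIdx N, (∏ i, c i (x i)) • tensorOp fun i => P i (x i) := by
  ext y z
  simp only [tensorOp, Matrix.of_apply, Matrix.sum_apply, Matrix.smul_apply, smul_eq_mul,
    ← Finset.prod_mul_distrib]
  exact prod_sum_qubits fun i b => c i b * P i b (y i) (z i)

/-- A separable state is a mixture of pure product states. -/
lemma exists_pure_product_decomposition {ρ : Op (QIdx N)} (h : ρ ∈ sepStates N) :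
    ∃ (K : ℕ) (p : Fin K × QIdx N → ℝ) (φ : Fin K × QIdx N → Fin N → Fin 2 → ℂ),
      (∀ g, 0 ≤ p g) ∧ ∑ g, p g = 1 ∧ (∀ g i, IsUnitVec (φ g i)) ∧
      ρ = ∑ g, (p g : ℂ) • pureState (tensorVec (φ g)) := by
  obtain ⟨K, p, τ, hp, hp1, hτ, rfl⟩ := h
  choose μ φ hμ hμ1 hφ hd using fun g i => exists_pure_decomposition (hτ g i)
  -- Each one-qubit factor is diagonalized and the product multiplied out; the bit string records
  -- which eigenvector is chosen at each site.
  refine ⟨K, fun gx => p gx.1 * ∏ i, μ gx.1 i (gx.2 i), fun gx i => φ gx.1 i (gx.2 i),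
    fun gx => mul_nonneg (hp _) (Finset.prod_nonneg fun i _ => hμ _ _ _), ?_,
    fun gx i => hφ _ _ _, ?_⟩
  · rw [Fintype.sum_prod_type, ← hp1]
    refine Finset.sum_congr rfl fun g _ => ?_
    change ∑ x : QIdx N, p g * ∏ i, μ g i (x i) = p g
    rw [← Finset.mul_sum, ← prod_sum_qubits (fun i b => μ g i b)]
    simp only [hμ1, Finset.prod_const_one, mul_one]
  · rw [Fintype.sum_prod_type]
    refine Finset.sum_congr rfl fun g _ => ?_
    have h1 : tensorOp (τ g) =
        ∑ x : QIdx N, (∏ i, (μ g i (x i) : ℂ)) • tensorOp fun i => pureState (φ g i (x i)) := by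
      rw [← tensorOp_sum (fun i b => (μ g i b : ℂ)) fun i b => pureState (φ g i b)]
      exact congrArg tensorOp (funext fun i => hd g i)
    rw [h1, Finset.smul_sum]
    refine Finset.sum_congr rfl fun x _ => ?_
    rw [smul_smul, pureState_tensorVec]
    push_cast
    rfl

theorem sepStates_subset_allStates : sepStates N ⊆ allStates N := by
  intro ρ h
  obtain ⟨K, p, φ, hp, hp1, hφ, rfl⟩ := exists_pure_product_decomposition h
  refine ⟨Matrix.posSemidef_sum _ fun g _ => (posSemidef_pureState _).smul ?_, ?_⟩
  · exact_mod_cast hp g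
  · rw [Matrix.trace_sum]
    simp only [Matrix.trace_smul, (isState_pureState (isUnitVec_tensorVec (hφ _))).2, smul_eq_mul,
      mul_one]
    exact_mod_cast hp1

theorem worstCase_planeAxes_le_of_mem_sepStates {ν : EuclideanSpace ℝ (Fin 3)} (hν : ‖ν‖ = 1)
    {ρ : Op (QIdx N)} (h : ρ ∈ sepStates N) : worstCase (planeAxes ν) ρ ≤ N := by
  obtain ⟨n, hn⟩ := exists_mem_planeAxes ν
  have h1 := two_mul_worstCase_planeAxes_le hν hn (sepStates_subset_allStates h)
  obtain ⟨K, p, φ, hp, hp1, hφ, rfl⟩ := exists_pure_product_decomposition h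
  have hst := fun g => isState_pureState (isUnitVec_tensorVec (hφ g))
  have h2 := qfi_mixture_le hp hst (isHermitian_collectiveSpin n)
  have h3 := qfi_mixture_le hp hst (isHermitian_collectiveSpin (cross ν n))
  have h4 : ∑ g, p g * (variance (pureState (tensorVec (φ g))) (collectiveSpin N n) +
      variance (pureState (tensorVec (φ g))) (collectiveSpin N (cross ν n))) ≤
      ∑ g, p g * (N / 2) :=
    Finset.sum_le_sum fun g _ => mul_le_mul_of_nonneg_left
      (variance_add_variance_tensorVec_le hν hn (hφ g)) (hp g)
  rw [← Finset.sum_mul, hp1] at h4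
  simp only [mul_add, Finset.sum_add_distrib] at h4
  linarith

theorem worstCase_allAxes_le_of_mem_sepStates {ρ : Op (QIdx N)} (h : ρ ∈ sepStates N) :
    worstCase allAxes ρ ≤ 2 / 3 * (N : ℝ) := by
  have h1 := three_mul_worstCase_allAxes_le orthonormal_single (sepStates_subset_allStates h)
  obtain ⟨K, p, φ, hp, hp1, hφ, rfl⟩ := exists_pure_product_decomposition h
  have hst := fun g => isState_pureState (isUnitVec_tensorVec (hφ g))
  refine le_of_mul_le_mul_left (h1.trans ((Finset.sum_le_sum fun k _ =>
    qfi_mixture_le hp hst (isHermitian_collectiveSpin _)).trans_eq ?_)) (zero_lt_three' ℝ)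
  rw [← Finset.mul_sum, Finset.sum_comm]
  simp only [← Finset.mul_sum, sum_variance_tensorVec orthonormal_single (hφ _)]
  rw [← Finset.sum_mul, hp1]
  ring

end Product

/-! ### Expectation values in vectors -/

section Expect

variable {ι : Type} [Fintype ι]

/-- The expectation value `⟨ψ, A ψ⟩` as a linear functional of `A`. -/
def expect (ψ : ι → ℂ) : Op ι →ₗ[ℂ] ℂ where
  toFun A := star ψ ⬝ᵥ (A *ᵥ ψ)
  map_add' A B := by rw [Matrix.add_mulVec, dotProduct_add]
  map_smul' c A := by rw [Matrix.smul_mulVec, dotProduct_smul, RingHom.id_apply]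

lemma expect_apply (ψ : ι → ℂ) (A : Op ι) : expect ψ A = star ψ ⬝ᵥ (A *ᵥ ψ) := rfl

lemma expect_im_eq_zero (ψ : ι → ℂ) {A : Op ι} (hA : A.IsHermitian) : (expect ψ A).im = 0 := by
  rw [expect_apply, ← trace_pureState_mul]
  exact trace_mul_im_eq_zero (posSemidef_pureState ψ).isHermitian hA

lemma variance_pureState (ψ : ι → ℂ) (A : Op ι) :
    variance (pureState ψ) A = (expect ψ (A * A)).re - (expect ψ A).re ^ 2 := by
  rw [variance, trace_pureState_mul, trace_pureState_mul]
  rfl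

lemma mul_pureState (A : Op ι) (ψ : ι → ℂ) :
    A * pureState ψ = Matrix.vecMulVec (A *ᵥ ψ) (star ψ) :=
  Matrix.mul_vecMulVec _ _ _

lemma pureState_mulVec (A : Op ι) (ψ : ι → ℂ) :
    pureState (A *ᵥ ψ) = A * pureState ψ * Aᴴ := by
  rw [mul_pureState, Matrix.vecMulVec_mul, pureState, Matrix.star_mulVec]

lemma star_dotProduct_self (ψ : ι → ℂ) : star ψ ⬝ᵥ ψ = ((∑ x, ‖ψ x‖ ^ 2 : ℝ) : ℂ) := by
  push_cast
  exact Finset.sum_congr rfl fun x _ => Complex.conj_mul' _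

lemma isUnitVec_iff {ψ : ι → ℂ} : IsUnitVec ψ ↔ ∑ x, ‖ψ x‖ ^ 2 = 1 := by
  rw [IsUnitVec, star_dotProduct_self]
  exact_mod_cast Iff.rfl

lemma isUnitVec_mulVec [DecidableEq ι] {W : Op ι} (hW : Wᴴ * W = 1) {ψ : ι → ℂ}
    (h : IsUnitVec ψ) : IsUnitVec (W *ᵥ ψ) := by
  rw [IsUnitVec, Matrix.star_mulVec, ← Matrix.dotProduct_mulVec, Matrix.mulVec_mulVec, hW,
    Matrix.one_mulVec]
  exact h

end Expect

/-! ### Optimality criteria for pure states -/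

section Criteria

variable {N : ℕ} {ψ : QIdx N → ℂ}

lemma expect_totalSpinSq (h : IsUnitVec ψ) (hs : IsSymmetricVec ψ) :
    expect ψ (totalSpinSq N) = ((N * (N + 2) / 4 : ℝ) : ℂ) := by
  rw [expect_apply, totalSpinSq_mulVec_of_symmetric hs, dotProduct_smul, h, smul_eq_mul, mul_one]

lemma collectiveSpin_neg (n : EuclideanSpace ℝ (Fin 3)) :
    collectiveSpin N (-n) = -collectiveSpin N n := by
  simp only [collectiveSpin_eq_sum, PiLp.neg_apply, Complex.ofReal_neg, neg_smul,
    Finset.sum_neg_distrib]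

lemma expect_commutator_eq_zero {A : Op (QIdx N)} (hA : A.IsHermitian) (h : A *ᵥ ψ = 0)
    (B : Op (QIdx N)) : expect ψ (A * B - B * A) = 0 := by
  have h1 : star ψ ᵥ* A = 0 := by
    rw [← star_eq_zero, Matrix.star_vecMul, star_star, hA.eq, h]
  rw [map_sub, expect_apply, expect_apply, ← Matrix.mulVec_mulVec, ← Matrix.mulVec_mulVec, h,
    Matrix.mulVec_zero, dotProduct_zero, Matrix.dotProduct_mulVec, h1, zero_dotProduct, sub_zero]

/-- Since L_ν annihilates ψ, every commutator with L_ν has zero expectation. This gives ⟨L_n⟩ = 0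
and equal second moments in the plane; the Casimir value is then shared by two axes. -/
theorem qfi_of_isTwinFock {ν n : EuclideanSpace ℝ (Fin 3)} (hν : ‖ν‖ = 1) (h : IsTwinFock ν ψ)
    (hn : n ∈ planeAxes ν) :
    qfi (pureState ψ) (collectiveSpin N n) = (N : ℝ) * (N + 2) / 2 := by
  obtain ⟨hu, hs, h0⟩ := h
  have hI : Complex.I ≠ 0 := Complex.I_ne_zero
  have hc := expect_commutator_eq_zero (isHermitian_collectiveSpin ν) h0
  have c1 := collectiveSpin_commutator (N := N) ν n
  have c2 := collectiveSpin_commutator (N := N) ν (cross ν n)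
  rw [cross_cross hν hn.2, collectiveSpin_neg] at c2
  set Ln := collectiveSpin N n with hLn
  set Lm := collectiveSpin N (cross ν n) with hLm
  set Lν := collectiveSpin N ν with hLν
  have e1 : expect ψ Ln = 0 := by
    have h1 := hc Lm
    rw [c2, map_smul, map_neg, smul_eq_mul] at h1
    simpa using h1
  have e2 : expect ψ (Lm * Lm) = expect ψ (Ln * Ln) := by
    -- Infinitesimal rotation about ν: the commutator with Ln·Lm is i(Lm² − Ln²).
    have h1 := hc (Ln * Lm)
    have h2 : Lν * (Ln * Lm) - Ln * Lm * Lν = Complex.I • (Lm * Lm - Ln * Ln) := by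
      calc Lν * (Ln * Lm) - Ln * Lm * Lν = (Lν * Ln - Ln * Lν) * Lm + Ln * (Lν * Lm - Lm * Lν) := by
            noncomm_ring
        _ = _ := by
            rw [c1, c2, Matrix.smul_mul, Matrix.mul_smul, Matrix.mul_neg, ← smul_add,
              sub_eq_add_neg]
    rw [h2, map_smul, map_sub, smul_eq_mul] at h1
    exact sub_eq_zero.mp ((mul_eq_zero.mp h1).resolve_left hI)
  have e3 : expect ψ (Lν * Lν) = 0 := by
    rw [expect_apply, ← Matrix.mulVec_mulVec, h0, Matrix.mulVec_zero, dotProduct_zero]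
  have e4 := expect_totalSpinSq hu hs
  rw [← sum_collectiveSpin_sq (orthonormal_frame hn.1 hν hn.2), Fin.sum_univ_three] at e4
  simp only [Matrix.cons_val, ← hLn, ← hLm, ← hLν, map_add, e2, e3, add_zero] at e4
  have e5 := congrArg Complex.re e4
  rw [Complex.add_re, Complex.ofReal_re] at e5
  rw [qfi_pureState hu (isHermitian_collectiveSpin n), variance_pureState, e1, Complex.zero_re]
  linarith

theorem worstCase_of_isTwinFock {ν : EuclideanSpace ℝ (Fin 3)} (hν : ‖ν‖ = 1)
    (h : IsTwinFock ν ψ) :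
    worstCase (planeAxes ν) (pureState ψ) = (N : ℝ) * (N + 2) / 2 :=
  worstCase_eq_of_forall (exists_mem_planeAxes ν) fun _ hn => qfi_of_isTwinFock hν h hn

/-- Comparing n with −n kills the mean, and the Casimir value is shared equally by three axes. -/
theorem worstCase_of_isAnticoherent (h : IsAnticoherent ψ) :
    worstCase allAxes (pureState ψ) = (N : ℝ) * (N + 2) / 3 := by
  obtain ⟨hu, hs, hk⟩ := h
  refine worstCase_eq_of_forall nonempty_allAxes fun n hn => ?_
  have e1 : expect ψ (collectiveSpin N n) = 0 := by
    have h1 := hk 1 (by simp) n hn (-n) (by simpa [allAxes] using hn)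
    rw [pow_one, pow_one, collectiveSpin_neg, ← expect_apply, ← expect_apply, map_neg] at h1
    exact self_eq_neg.mp h1
  have e2 : ∀ k : Fin 3, expect ψ (collectiveSpin N (EuclideanSpace.single k 1) *
      collectiveSpin N (EuclideanSpace.single k 1)) =
      expect ψ (collectiveSpin N n * collectiveSpin N n) := fun k => by
    have h1 := hk 2 (by simp) (EuclideanSpace.single k 1) (by simp [allAxes]) n hn
    rwa [sq, sq] at h1
  have e3 := expect_totalSpinSq hu hs
  rw [← sum_collectiveSpin_sq orthonormal_single, map_sum, Finset.sum_congr rfl fun k _ => e2 k]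
    at e3
  have e4 := congrArg Complex.re e3
  simp only [Finset.sum_const, Finset.card_univ, Fintype.card_fin, nsmul_eq_mul,
    Complex.ofReal_re] at e4
  simp at e4
  rw [qfi_pureState hu (isHermitian_collectiveSpin n), variance_pureState, e1, Complex.zero_re]
  linarith

lemma variance_eq_sum_spinCovariance (ρ : Op (QIdx N)) (n : EuclideanSpace ℝ (Fin 3)) :
    variance ρ (collectiveSpin N n) = ∑ a, ∑ b, n a * n b * spinCovariance ρ a b := by
  have e1 : (ρ * collectiveSpin N n).trace.re = ∑ a, n a * (ρ * spinComponent N a).trace.re := by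
    rw [collectiveSpin_eq_sum, Finset.mul_sum, Matrix.trace_sum, Complex.re_sum]
    refine Finset.sum_congr rfl fun a _ => ?_
    rw [Matrix.mul_smul, Matrix.trace_smul, smul_eq_mul, Complex.re_ofReal_mul]
  have e2 : (ρ * (collectiveSpin N n * collectiveSpin N n)).trace.re =
      ∑ a, ∑ b, n a * n b * (ρ * (spinComponent N a * spinComponent N b)).trace.re := by
    rw [collectiveSpin_eq_sum, Finset.sum_mul_sum, Finset.mul_sum, Matrix.trace_sum,
      Complex.re_sum]
    refine Finset.sum_congr rfl fun a _ => ?_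
    rw [Finset.mul_sum, Matrix.trace_sum, Complex.re_sum]
    refine Finset.sum_congr rfl fun b _ => ?_
    rw [Matrix.smul_mul, Matrix.mul_smul, Matrix.mul_smul, Matrix.mul_smul, Matrix.trace_smul,
      Matrix.trace_smul, smul_eq_mul, smul_eq_mul, Complex.re_ofReal_mul, Complex.re_ofReal_mul,
      mul_assoc]
  rw [variance, e1, e2]
  simp only [Fin.sum_univ_three, spinCovariance, Matrix.of_apply, Matrix.mul_add,
    Matrix.trace_add, Complex.add_re]
  ring

lemma spinCovariance_comm (ρ : Op (QIdx N)) (a b : Fin 3) :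
    spinCovariance ρ a b = spinCovariance ρ b a := by
  rw [spinCovariance, Matrix.of_apply, Matrix.of_apply,
    add_comm (spinComponent N a * spinComponent N b)]
  ring

lemma sum_smul_one (n : EuclideanSpace ℝ (Fin 3)) (c : ℝ) :
    ∑ a, ∑ b, n a * n b * (c • (1 : Matrix (Fin 3) (Fin 3) ℝ)) a b =
      c * (n 0 ^ 2 + n 1 ^ 2 + n 2 ^ 2) := by
  simp [Fin.sum_univ_three]
  ring

/-- A symmetric matrix is determined by its quadratic form. The coordinate axes give the diagonal,
and rational unit vectors built from 3/5 and 4/5 isolate each off-diagonal entry. -/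
lemma spinCovariance_eq_smul_one {ρ : Op (QIdx N)} {c : ℝ}
    (h : ∀ n : EuclideanSpace ℝ (Fin 3), ‖n‖ = 1 → variance ρ (collectiveSpin N n) = c) :
    spinCovariance ρ = c • 1 := by
  have hd : ∀ a, spinCovariance ρ a a = c := fun a => by
    have h1 := h (EuclideanSpace.single a 1) (by simp)
    rw [variance_eq_sum_spinCovariance, Finset.sum_eq_single a, Finset.sum_eq_single a] at h1
    · simpa using h1
    · intro b _ hb; simp [hb]
    · simp
    · intro b _ hb; simp [hb]
    · simp
  have hn : ∀ x y z : ℝ, x ^ 2 + y ^ 2 + z ^ 2 = 1 →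
      x * y * spinCovariance ρ 0 1 + x * z * spinCovariance ρ 0 2 +
        y * z * spinCovariance ρ 1 2 = 0 := fun x y z hxyz => by
    have hnorm : ‖(!₂[x, y, z] : EuclideanSpace ℝ (Fin 3))‖ = 1 := by
      have : ‖(!₂[x, y, z] : EuclideanSpace ℝ (Fin 3))‖ ^ 2 = 1 := by
        rw [EuclideanSpace.real_norm_sq_eq, Fin.sum_univ_three]
        simpa using hxyz
      exact (pow_eq_one_iff_of_nonneg (norm_nonneg _) two_ne_zero).mp this
    have h1 := h _ hnorm
    rw [variance_eq_sum_spinCovariance] at h1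
    simp [Fin.sum_univ_three, hd, spinCovariance_comm ρ 1 0, spinCovariance_comm ρ 2 0,
      spinCovariance_comm ρ 2 1] at h1
    linear_combination (1 / 2) * h1 - (c / 2) * hxyz
  have h01 : spinCovariance ρ 0 1 = 0 := by
    have := hn (3 / 5) (4 / 5) 0 (by norm_num)
    linarith
  have h02 : spinCovariance ρ 0 2 = 0 := by
    have := hn (3 / 5) 0 (4 / 5) (by norm_num)
    linarith
  have h12 : spinCovariance ρ 1 2 = 0 := by
    have := hn 0 (3 / 5) (4 / 5) (by norm_num)
    linarith
  ext a b
  fin_cases a <;> fin_cases b <;>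
    simp [hd, h01, h02, h12, spinCovariance_comm ρ 1 0, spinCovariance_comm ρ 2 0,
      spinCovariance_comm ρ 2 1]

lemma tensorOp_mem_sepStates {τ : Fin N → Op (Fin 2)} (h : ∀ i, IsState (τ i)) :
    tensorOp τ ∈ sepStates N :=
  ⟨1, fun _ => 1, fun _ => τ, fun _ => zero_le_one, by simp, fun _ => h, by simp⟩

/-- The trace of the covariance matrix of a pure product state is N/2, which forces the constant to
be N/6. -/
theorem worstCase_of_isIsotropicProduct (h : IsIsotropicProduct ψ) :
    pureState ψ ∈ sepStates N ∧ worstCase allAxes (pureState ψ) = 2 / 3 * (N : ℝ) := by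
  obtain ⟨⟨φ, hφ, rfl⟩, c, hc⟩ := h
  refine ⟨?_, worstCase_eq_of_forall nonempty_allAxes fun n hn => ?_⟩
  · rw [pureState_tensorVec]
    exact tensorOp_mem_sepStates fun i => isState_pureState (hφ i)
  have hv : ∀ n : EuclideanSpace ℝ (Fin 3), ‖n‖ = 1 →
      variance (pureState (tensorVec φ)) (collectiveSpin N n) = c := fun n hn => by
    rw [variance_eq_sum_spinCovariance, hc, sum_smul_one, sum_sq_eq_one hn, mul_one]
  have h1 := sum_variance_tensorVec orthonormal_single hφ
  rw [Finset.sum_congr rfl fun k _ => hv _ (orthonormal_single.1 k)] at h1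
  simp at h1
  rw [qfi_pureState (isUnitVec_tensorVec hφ) (isHermitian_collectiveSpin n), hv n hn]
  linarith

end Criteria

/-! ### An isotropic product state -/

section Isotropic

variable {N : ℕ}

lemma sum_pow_eq_zero_of_pow_eq_one {x : ℂ} (h : x ^ N = 1) (h1 : x ≠ 1) :
    ∑ k : Fin N, x ^ (k : ℕ) = 0 := by
  rw [Fin.sum_univ_eq_sum_range fun k => x ^ k, geom_sum_eq h1, h, sub_self, zero_div]

/-- The Bloch vectors are equally spaced on a cone about the z axis. For N ≥ 3 both ω and ω² differ
from 1, so the first and second azimuthal harmonics sum to zero and only the cone's opening has to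
be tuned. -/
theorem exists_isIsotropicProduct (hN : 3 ≤ N) : ∃ ψ : QIdx N → ℂ, IsIsotropicProduct ψ := by
  obtain ⟨ω, hω⟩ : ∃ ω : ℂ, IsPrimitiveRoot ω N := ⟨_, Complex.isPrimitiveRoot_exp N (by omega)⟩
  have hnorm : ∀ k : ℕ, (ω ^ k).re ^ 2 + (ω ^ k).im ^ 2 = 1 := fun k => by
    have h1 : ‖ω ^ k‖ = 1 := by rw [norm_pow, hω.norm'_eq_one (by omega), one_pow]
    have h2 := Complex.sq_norm (ω ^ k)
    rw [h1, Complex.normSq_apply] at h2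
    linarith
  have s1 := sum_pow_eq_zero_of_pow_eq_one hω.pow_eq_one (hω.ne_one (by omega))
  have s2 : ∑ k : Fin N, (ω ^ 2) ^ (k : ℕ) = 0 := by
    refine sum_pow_eq_zero_of_pow_eq_one ?_ ?_
    · rw [← pow_mul, mul_comm, pow_mul, hω.pow_eq_one, one_pow]
    · exact hω.pow_ne_one_of_pos_of_lt two_ne_zero (by omega)
  -- The height of the cone: its square must be 1/3, the average of a squared component of a unit
  -- vector. Then α and β are the half-angle amplitudes.
  set t : ℝ := √(1 / 3) with ht
  have ht2 : t ^ 2 = 1 / 3 := Real.sq_sqrt (by norm_num)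
  have ht0 : 0 ≤ t := Real.sqrt_nonneg _
  have ht1 : t ≤ 1 := by nlinarith
  set α : ℝ := √((1 + t) / 2) with hα
  set β : ℝ := √((1 - t) / 2) with hβ
  have hα2 : α ^ 2 = (1 + t) / 2 := Real.sq_sqrt (by linarith)
  have hβ2 : β ^ 2 = (1 - t) / 2 := Real.sq_sqrt (by linarith)
  set φ : Fin N → Fin 2 → ℂ := fun k => ![(α : ℂ), β * ω ^ (k : ℕ)] with hφ
  have hφu : ∀ k, IsUnitVec (φ k) := fun k => by
    rw [isUnitVec_iff, Fin.sum_univ_two]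
    simp only [hφ, Matrix.cons_val_zero, Matrix.cons_val_one, norm_mul, norm_pow,
      hω.norm'_eq_one (by omega), one_pow, mul_one, Complex.norm_real, Real.norm_eq_abs, sq_abs]
    linear_combination hα2 + hβ2
  refine ⟨tensorVec φ, ⟨φ, hφu, rfl⟩, N / 6, spinCovariance_eq_smul_one fun n hn => ?_⟩
  rw [variance_tensorVec hφu hn]
  have hαβ : 4 * α ^ 2 * β ^ 2 = 2 / 3 := by rw [hα2, hβ2]; linear_combination - ht2
  have hαβt : α ^ 2 - β ^ 2 = t := by rw [hα2, hβ2]; ring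
  -- Double-angle formulas separate the isotropic constant 1 − 1/3 from the harmonics that cancel in
  -- the sum.
  have hterm : ∀ k : Fin N, 1 - inner ℝ (bloch (φ k)) n ^ 2 = 2 / 3 -
      (1 / 3 * (n 0 ^ 2 - n 1 ^ 2) * ((ω ^ 2) ^ (k : ℕ)).re
        + 2 / 3 * (n 0 * n 1) * ((ω ^ 2) ^ (k : ℕ)).im
        + 4 * α * β * t * (n 2 * n 0) * (ω ^ (k : ℕ)).re
        + 4 * α * β * t * (n 2 * n 1) * (ω ^ (k : ℕ)).im) := fun k => by
    have hk := hnorm k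
    have hn2 := sum_sq_eq_one hn
    have hsq : (ω ^ 2) ^ (k : ℕ) = ω ^ (k : ℕ) * ω ^ (k : ℕ) := by ring
    rw [inner_eq_sum, hsq, Complex.mul_re, Complex.mul_im]
    have hb : bloch (φ k) = !₂[2 * α * β * (ω ^ (k : ℕ)).re, 2 * α * β * (ω ^ (k : ℕ)).im, t] := by
      ext a
      fin_cases a <;> simp [bloch, hφ]
      · ring
      · ring
      · linear_combination hαβt - β ^ 2 * hk
    rw [hb]
    generalize (ω ^ (k : ℕ)).re = C at *
    generalize (ω ^ (k : ℕ)).im = S at *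
    simp
    linear_combination -(C * n 0 + S * n 1) ^ 2 * hαβ - n 2 ^ 2 * ht2 -
      (n 0 ^ 2 + n 1 ^ 2) / 3 * hk - (1 / 3) * hn2
  rw [Finset.sum_congr rfl fun k _ => hterm k]
  have r1 : ∑ k : Fin N, (ω ^ (k : ℕ)).re = 0 := by rw [← Complex.re_sum, s1, Complex.zero_re]
  have i1 : ∑ k : Fin N, (ω ^ (k : ℕ)).im = 0 := by rw [← Complex.im_sum, s1, Complex.zero_im]
  have r2 : ∑ k : Fin N, ((ω ^ 2) ^ (k : ℕ)).re = 0 := by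
    rw [← Complex.re_sum, s2, Complex.zero_re]
  have i2 : ∑ k : Fin N, ((ω ^ 2) ^ (k : ℕ)).im = 0 := by
    rw [← Complex.im_sum, s2, Complex.zero_im]
  simp only [Finset.sum_sub_distrib, Finset.sum_add_distrib, ← Finset.mul_sum, r1, i1, r2, i2,
    Finset.sum_const, Finset.card_univ, Fintype.card_fin, nsmul_eq_mul]
  ring

end Isotropic

/-! ### Dicke states -/

section Dicke

variable {N : ℕ}

/-- The number of excited qubits. -/
def weight (x : QIdx N) : ℕ := ∑ i, (x i : ℕ)

lemma weight_comp (x : QIdx N) (π : Equiv.Perm (Fin N)) : weight (x ∘ π) = weight x :=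
  Equiv.sum_comp π fun i => (x i : ℕ)

lemma weight_le (x : QIdx N) : weight x ≤ N := by
  calc weight x ≤ ∑ _i : Fin N, 1 := Finset.sum_le_sum fun i _ => by omega
    _ = N := by simp

lemma exists_weight_eq {k : ℕ} (h : k ≤ N) : ∃ x : QIdx N, weight x = k := by
  refine ⟨fun i => if (i : ℕ) < k then 1 else 0, ?_⟩
  have : ∀ i : Fin N, (((if (i : ℕ) < k then 1 else 0 : Fin 2)) : ℕ) =
      if (i : ℕ) < k then 1 else 0 := fun i => by split_ifs <;> rfl
  simp only [weight, this]
  rw [Finset.sum_boole, Fin.card_filter_val_lt, min_eq_right h]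
  rfl

lemma spinComponent_two_mulVec (ψ : QIdx N → ℂ) (x : QIdx N) :
    (spinComponent N 2 *ᵥ ψ) x = ((N / 2 - weight x : ℝ) : ℂ) * ψ x := by
  have h : ∀ i, (onSite i (pauli 2) *ᵥ ψ) x = (1 - 2 * ((x i : ℕ) : ℂ)) * ψ x := fun i => by
    rw [onSite_mulVec, Fin.sum_univ_two]
    have hx : x i = 0 ∨ x i = 1 := by omega
    rcases hx with hx | hx
    · have : Function.update x i 0 = x := by rw [← hx, Function.update_eq_self]
      rw [this, hx]
      simp [pauli]
    · have : Function.update x i 1 = x := by rw [← hx, Function.update_eq_self]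
      rw [this, hx]
      simp [pauli]
      norm_num
  rw [spinComponent_eq, Matrix.smul_mulVec, Matrix.sum_mulVec, Pi.smul_apply, Finset.sum_apply,
    Finset.sum_congr rfl fun i _ => h i, ← Finset.sum_mul, Finset.sum_sub_distrib,
    ← Finset.mul_sum, weight]
  push_cast
  simp
  ring

/-- `A` maps vectors of weight `w + d` to vectors of weight `w`. -/
def LowersWeight (d : ℕ) (A : Op (QIdx N)) : Prop :=
  ∀ x y, A x y ≠ 0 → weight y = weight x + d

lemma LowersWeight.mul {d e : ℕ} {A B : Op (QIdx N)} (hA : LowersWeight d A)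
    (hB : LowersWeight e B) : LowersWeight (d + e) (A * B) := by
  intro x y h
  obtain ⟨z, -, hz⟩ := Finset.exists_ne_zero_of_sum_ne_zero h
  have h1 := hA x z (left_ne_zero_of_mul hz)
  have h2 := hB z y (right_ne_zero_of_mul hz)
  omega

lemma lowersWeight_sum_onSite {d : ℕ} {A : Op (Fin 2)}
    (hA : ∀ a b, A a b ≠ 0 → (b : ℕ) = a + d) : LowersWeight d (∑ i : Fin N, onSite i A) := by
  intro x y h
  rw [Matrix.sum_apply] at h
  obtain ⟨i, -, hi⟩ := Finset.exists_ne_zero_of_sum_ne_zero h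
  have h1 : ∀ j, j ≠ i → x j = y j := by
    by_contra! hcon
    exact hi (onSite_eq_zero A hcon)
  rw [onSite_apply] at hi
  have h2 := hA _ _ (left_ne_zero_of_mul hi)
  rw [weight, weight, ← Finset.add_sum_erase _ _ (Finset.mem_univ i),
    ← Finset.add_sum_erase _ (fun i => (x i : ℕ)) (Finset.mem_univ i), h2,
    Finset.sum_congr rfl fun j hj => congrArg Fin.val (h1 j (Finset.ne_of_mem_erase hj))]
  ring

lemma LowersWeight.smul {d : ℕ} {A : Op (QIdx N)} (hA : LowersWeight d A) (c : ℂ) :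
    LowersWeight d (c • A) :=
  fun x y h => hA x y (right_ne_zero_of_mul h)

/-- The ladder operator `L_x + i L_y`. -/
noncomputable def spinRaising (N : ℕ) : Op (QIdx N) :=
  spinComponent N 0 + Complex.I • spinComponent N 1

lemma lowersWeight_spinRaising : LowersWeight 1 (spinRaising N) := by
  have h : spinRaising N = ∑ i, onSite i !![0, 1; 0, 0] := by
    have h1 : (!![0, 1; 0, 0] : Op (Fin 2)) =
        (1 / 2 : ℂ) • pauli 0 + (Complex.I * (1 / 2)) • pauli 1 := by
      ext a b
      fin_cases a <;> fin_cases b <;> simp [pauli] <;> ring_nf <;> simp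
      norm_num
    simp only [h1, onSite_add, onSite_smul, Finset.sum_add_distrib, ← Finset.smul_sum]
    rw [spinRaising, spinComponent_eq, spinComponent_eq, smul_smul]
  rw [h]
  refine lowersWeight_sum_onSite fun a b hab => ?_
  fin_cases a <;> fin_cases b <;> simp at hab ⊢

lemma lowersWeight_spinComponent_two : LowersWeight 0 (spinComponent N 2) := by
  rw [spinComponent_eq]
  refine (lowersWeight_sum_onSite fun a b hab => ?_).smul _
  fin_cases a <;> fin_cases b <;> simp [pauli] at hab ⊢

/-- Selection rule: an operator shifting the weight by `d` has no matrix elements within a support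
that has no two weights differing by `d`. -/
lemma expect_eq_zero_of_lowersWeight {d : ℕ} {A : Op (QIdx N)} (hA : LowersWeight d A)
    {ψ : QIdx N → ℂ} (hψ : ∀ x y, ψ x ≠ 0 → ψ y ≠ 0 → weight y ≠ weight x + d) :
    expect ψ A = 0 := by
  refine Finset.sum_eq_zero fun x _ => ?_
  by_cases hx : ψ x = 0
  · simp [hx]
  · refine mul_eq_zero_of_right _ (Finset.sum_eq_zero fun y _ => ?_)
    by_cases hy : ψ y = 0
    · simp [hy]
    · refine mul_eq_zero_of_left ?_ _
      by_contra hxy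
      exact hψ x y hx hy (hA x y hxy)

lemma isHermitian_spinComponent (a : Fin 3) : (spinComponent N a).IsHermitian :=
  isHermitian_collectiveSpin _

/-- Splits a complex ladder-operator identity into its two real, Hermitian components. -/
lemma ofReal_add_I_mul_eq_zero {x y : ℂ} (hx : x.im = 0) (hy : y.im = 0)
    (h : x + Complex.I * y = 0) : x = 0 ∧ y = 0 := by
  have h1 := congrArg Complex.re h
  have h2 := congrArg Complex.im h
  simp [hx, hy] at h1 h2
  exact ⟨Complex.ext h1 hx, Complex.ext h2 hy⟩

lemma expect_anticommutator_im (ψ : QIdx N → ℂ) (a b : Fin 3) :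
    (expect ψ (spinComponent N a * spinComponent N b) +
      expect ψ (spinComponent N b * spinComponent N a)).im = 0 := by
  rw [← map_add]
  refine expect_im_eq_zero ψ ?_
  rw [Matrix.IsHermitian, Matrix.conjTranspose_add, Matrix.conjTranspose_mul,
    Matrix.conjTranspose_mul, (isHermitian_spinComponent a).eq, (isHermitian_spinComponent b).eq,
    add_comm]

lemma expect_spinComponent_sq_im (ψ : QIdx N → ℂ) (a : Fin 3) :
    (expect ψ (spinComponent N a * spinComponent N a)).im = 0 := by
  have := expect_anticommutator_im ψ a a
  rw [Complex.add_im] at this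
  linarith

/-- Symmetric vectors with well-separated weights and the right first and second moments of the
weight are anti-coherent. -/
lemma isAnticoherent_of_weight {ψ : QIdx N → ℂ} (hu : IsUnitVec ψ) (hs : IsSymmetricVec ψ)
    (hsep : ∀ x y, ψ x ≠ 0 → ψ y ≠ 0 → weight y ≠ weight x + 1 ∧ weight y ≠ weight x + 2)
    (h1 : expect ψ (spinComponent N 2) = 0)
    (h2 : expect ψ (spinComponent N 2 * spinComponent N 2) = ((N * (N + 2) / 12 : ℝ) : ℂ)) :
    IsAnticoherent ψ := by
  have z1 : ∀ {A}, LowersWeight 1 A → expect ψ A = 0 := fun hA =>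
    expect_eq_zero_of_lowersWeight hA fun x y hx hy => (hsep x y hx hy).1
  have z2 : ∀ {A}, LowersWeight 2 A → expect ψ A = 0 := fun hA =>
    expect_eq_zero_of_lowersWeight hA fun x y hx hy => (hsep x y hx hy).2
  -- The operators L₊, L₊², L₊L_z and L_zL₊ shift the weight by 1 or 2. Their vanishing expectations
  -- remove the transverse means and all symmetrized mixed moments, and equate ⟨L_x²⟩ with ⟨L_y²⟩.
  have a1 := z1 (lowersWeight_spinRaising (N := N))
  have a2 := z2 ((lowersWeight_spinRaising (N := N)).mul lowersWeight_spinRaising)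
  have a3 := z1 (by simpa using
    (lowersWeight_spinRaising (N := N)).mul lowersWeight_spinComponent_two)
  have a4 := z1 (by simpa using
    (lowersWeight_spinComponent_two (N := N)).mul lowersWeight_spinRaising)
  simp only [spinRaising, map_add, map_smul, smul_eq_mul, Matrix.add_mul, Matrix.mul_add,
    Matrix.smul_mul, Matrix.mul_smul] at a1 a2 a3 a4
  have ht := expect_totalSpinSq hu hs
  rw [totalSpinSq, Fin.sum_univ_three, map_add, map_add, h2] at ht
  have him := expect_anticommutator_im ψ
  have hsq := expect_spinComponent_sq_im ψ
  obtain ⟨e0, e1⟩ := ofReal_add_I_mul_eq_zero (expect_im_eq_zero ψ (isHermitian_spinComponent 0))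
    (expect_im_eq_zero ψ (isHermitian_spinComponent 1)) a1
  have hE : ∀ a b : Fin 3, ∃ e : ℂ, expect ψ (spinComponent N a * spinComponent N b) = e :=
    fun a b => ⟨_, rfl⟩
  obtain ⟨e00, h00⟩ := hE 0 0
  obtain ⟨e01, h01⟩ := hE 0 1
  obtain ⟨e02, h02⟩ := hE 0 2
  obtain ⟨e10, h10⟩ := hE 1 0
  obtain ⟨e11, h11⟩ := hE 1 1
  obtain ⟨e12, h12⟩ := hE 1 2
  obtain ⟨e20, h20⟩ := hE 2 0
  obtain ⟨e21, h21⟩ := hE 2 1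
  have m01 := him 0 1
  have m02 := him 0 2
  have m12 := him 1 2
  have m00 := hsq 0
  have m11 := hsq 1
  rw [h00, h11] at ht
  simp only [h00, h01, h02, h10, h11, h12, h20, h21] at a2 a3 a4 m01 m02 m12 m00 m11
  obtain ⟨b1, b2⟩ := ofReal_add_I_mul_eq_zero (x := e00 - e11) (y := e01 + e10)
    (by rw [Complex.sub_im, m00, m11, sub_zero]) m01
    (by linear_combination a2 - e11 * Complex.I_mul_I)
  obtain ⟨b3, b4⟩ := ofReal_add_I_mul_eq_zero (x := e02 + e20) (y := e12 + e21) m02 m12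
    (by linear_combination a3 + a4)
  push_cast at ht
  -- The Casimir value minus the prescribed ⟨L_z²⟩ is split equally between x and y.
  have f00 : e00 = (N * (N + 2) / 12 : ℝ) := by
    push_cast
    linear_combination (1 / 2) * ht + (1 / 2) * b1
  have f11 : e11 = (N * (N + 2) / 12 : ℝ) := by
    push_cast
    linear_combination (1 / 2) * ht - (1 / 2) * b1
  have g1 : ∀ n : EuclideanSpace ℝ (Fin 3), expect ψ (collectiveSpin N n) = 0 := fun n => by
    rw [collectiveSpin_eq_sum, map_sum, Fin.sum_univ_three]
    simp only [map_smul, e0, e1, h1, smul_zero, add_zero]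
  have g2 : ∀ n ∈ allAxes, expect ψ (collectiveSpin N n * collectiveSpin N n) =
      ((N * (N + 2) / 12 : ℝ) : ℂ) := fun n hn => by
    have hn2 : (n 0 : ℂ) ^ 2 + (n 1 : ℂ) ^ 2 + (n 2 : ℂ) ^ 2 = 1 := by
      have := congrArg (fun r : ℝ => (r : ℂ)) (sum_sq_eq_one hn)
      push_cast at this
      exact this
    rw [collectiveSpin_eq_sum, Fin.sum_univ_three]
    simp only [Matrix.add_mul, Matrix.mul_add, Matrix.smul_mul, Matrix.mul_smul, map_add, map_smul,
      smul_eq_mul, h00, h01, h02, h10, h11, h12, h20, h21, h2, f00, f11]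
    linear_combination (n 0 : ℂ) * n 1 * b2 + (n 0 : ℂ) * n 2 * b3 + (n 1 : ℂ) * n 2 * b4 +
      ((N * (N + 2) / 12 : ℝ) : ℂ) * hn2
  refine ⟨hu, hs, fun k hk m hm n hn => ?_⟩
  rcases hk with rfl | rfl
  · rw [pow_one, pow_one, ← expect_apply, ← expect_apply, g1, g1]
  · rw [sq, sq, ← expect_apply, ← expect_apply, g2 m hm, g2 n hn]

/-- The superposition of Dicke states in which the weight has distribution `p`. -/
noncomputable def dicke (N : ℕ) (p : ℕ → ℝ) : QIdx N → ℂ := fun x =>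
  ((√(p (weight x) / (Finset.univ.filter fun y : QIdx N => weight y = weight x).card) : ℝ) : ℂ)

lemma isSymmetricVec_dicke (p : ℕ → ℝ) : IsSymmetricVec (dicke N p) := fun π x => by
  rw [dicke, dicke, weight_comp]

/-- The probability of a weight is spread evenly over its nonempty class of bit strings, so class
sizes cancel and expectations of functions of the weight become moments of `p`. -/
lemma sum_norm_dicke_sq {p : ℕ → ℝ} (hp : ∀ k, 0 ≤ p k) (g : ℕ → ℝ) :
    ∑ x, g (weight x) * ‖dicke N p x‖ ^ 2 = ∑ k ∈ Finset.range (N + 1), g k * p k := by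
  have h1 : ∀ x : QIdx N, ‖dicke N p x‖ ^ 2 =
      p (weight x) / (Finset.univ.filter fun y : QIdx N => weight y = weight x).card := fun x => by
    rw [dicke, Complex.norm_real, Real.norm_eq_abs, sq_abs]
    exact Real.sq_sqrt (div_nonneg (hp _) (Nat.cast_nonneg _))
  have him : Finset.univ.image (weight : QIdx N → ℕ) = Finset.range (N + 1) := by
    ext k
    simp only [Finset.mem_image, Finset.mem_univ, true_and, Finset.mem_range, Nat.lt_succ_iff]
    exact ⟨fun ⟨x, hx⟩ => hx ▸ weight_le x, exists_weight_eq⟩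
  simp only [h1]
  rw [Finset.sum_comp (fun k => g k * (p k / (Finset.univ.filter fun y : QIdx N =>
    weight y = k).card)) weight, him]
  refine Finset.sum_congr rfl fun k hk => ?_
  obtain ⟨x, hx⟩ := exists_weight_eq (Nat.lt_succ_iff.mp (Finset.mem_range.mp hk))
  have hne : ((Finset.univ.filter fun y : QIdx N => weight y = k).card : ℝ) ≠ 0 := by
    rw [Nat.cast_ne_zero]
    exact Finset.card_ne_zero_of_mem (Finset.mem_filter.mpr ⟨Finset.mem_univ x, hx⟩)
  rw [nsmul_eq_mul]
  field_simp

lemma isUnitVec_dicke {p : ℕ → ℝ} (hp : ∀ k, 0 ≤ p k)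
    (h1 : ∑ k ∈ Finset.range (N + 1), p k = 1) : IsUnitVec (dicke N p) := by
  rw [isUnitVec_iff, ← h1]
  simpa using sum_norm_dicke_sq (N := N) hp fun _ => 1

lemma dicke_ne_zero {p : ℕ → ℝ} {x : QIdx N} (h : dicke N p x ≠ 0) : p (weight x) ≠ 0 := by
  intro h0
  exact h (by simp [dicke, h0])

/-- Existence reduces to a moment problem: nodes never at distance 1 or 2, mean N/2, and variance
N(N+2)/12, a third of the Casimir value. -/
lemma isAnticoherent_dicke {m : ℕ} {K : Fin m → ℕ} {c : Fin m → ℝ} (hc : ∀ j, 0 ≤ c j)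
    (hK : ∀ j, K j ≤ N) (hsep : ∀ i j, K i ≠ K j + 1 ∧ K i ≠ K j + 2)
    (h0 : ∑ j, c j = 1) (h1 : ∑ j, (N / 2 - K j : ℝ) * c j = 0)
    (h2 : ∑ j, (N / 2 - K j : ℝ) ^ 2 * c j = N * (N + 2) / 12) :
    ∃ ψ : QIdx N → ℂ, IsAnticoherent ψ := by
  set p : ℕ → ℝ := fun k => ∑ j, if K j = k then c j else 0 with hpd
  have hp : ∀ k, 0 ≤ p k := fun k => Finset.sum_nonneg fun j _ => by
    split_ifs
    · exact hc j
    · exact le_rfl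
  have hsum : ∀ g : ℕ → ℝ, ∑ k ∈ Finset.range (N + 1), g k * p k = ∑ j, g (K j) * c j :=
    fun g => by
      simp only [hpd, Finset.mul_sum, mul_ite, mul_zero]
      rw [Finset.sum_comm]
      refine Finset.sum_congr rfl fun j _ => ?_
      rw [Finset.sum_ite_eq, if_pos (Finset.mem_range.mpr (Nat.lt_succ_of_le (hK j)))]
  have hsupp : ∀ x : QIdx N, dicke N p x ≠ 0 → ∃ j, K j = weight x := fun x hx => by
    obtain ⟨j, -, hj⟩ := Finset.exists_ne_zero_of_sum_ne_zero (dicke_ne_zero hx)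
    exact ⟨j, by_contra fun h => hj (if_neg h)⟩
  refine ⟨dicke N p, isAnticoherent_of_weight (isUnitVec_dicke hp ?_) (isSymmetricVec_dicke p)
    (fun x y hx hy => ?_) ?_ ?_⟩
  · simpa [h0] using hsum fun _ => 1
  · obtain ⟨i, hi⟩ := hsupp x hx
    obtain ⟨j, hj⟩ := hsupp y hy
    rw [← hi, ← hj]
    exact hsep j i
  · have h := (sum_norm_dicke_sq hp fun k => (N / 2 - k : ℝ)).trans ((hsum _).trans h1)
    have h' := congrArg (fun r : ℝ => (r : ℂ)) h
    simp only [Complex.ofReal_sum, Complex.ofReal_zero] at h'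
    rw [expect_apply, ← h']
    refine Finset.sum_congr rfl fun x _ => ?_
    rw [spinComponent_two_mulVec, Pi.star_apply, Complex.ofReal_mul, Complex.ofReal_pow,
      ← Complex.conj_mul', Complex.star_def]
    ring
  · have h := (sum_norm_dicke_sq hp fun k => (N / 2 - k : ℝ) ^ 2).trans ((hsum _).trans h2)
    have h' := congrArg (fun r : ℝ => (r : ℂ)) h
    simp only [Complex.ofReal_sum] at h'
    rw [expect_apply, ← h', ← Matrix.mulVec_mulVec]
    refine Finset.sum_congr rfl fun x _ => ?_
    rw [spinComponent_two_mulVec, spinComponent_two_mulVec, Pi.star_apply, Complex.ofReal_mul,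
      Complex.ofReal_pow, Complex.ofReal_pow, ← Complex.conj_mul', Complex.star_def]
    ring

theorem exists_isAnticoherent (hN : N = 4 ∨ 6 ≤ N) : ∃ ψ : QIdx N → ℂ, IsAnticoherent ψ := by
  rcases hN with rfl | hN
  -- The tetrahedral state of spin 2.
  · refine isAnticoherent_dicke (K := ![0, 3]) (c := ![1 / 3, 2 / 3]) ?_ ?_ ?_ ?_ ?_ ?_
    · intro j; fin_cases j <;> norm_num
    · intro j; fin_cases j <;> norm_num
    · intro i j; fin_cases i <;> fin_cases j <;> norm_num
    all_goals norm_num [Fin.sum_univ_two]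
  rcases Nat.even_or_odd' N with ⟨t, rfl | rfl⟩
  · have ht : (3 : ℝ) ≤ t := by exact_mod_cast (by omega : 3 ≤ t)
    -- With nodes 0, t, 2t symmetric about t, the second-moment condition is 2qt² = t(t + 1)/3. The
    -- gap t must be at least 3.
    set q : ℝ := (t + 1) / (6 * t) with hq
    have hqt : q * t = (t + 1) / 6 := by rw [hq]; field_simp
    have hq0 : 0 ≤ q := by positivity
    have hq1 : 0 ≤ 1 - 2 * q := by
      rw [hq, sub_nonneg, ← mul_div_assoc, div_le_one (by positivity)]
      linarith
    refine isAnticoherent_dicke (K := ![0, t, 2 * t]) (c := ![q, 1 - 2 * q, q]) ?_ ?_ ?_ ?_ ?_ ?_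
    · intro j; fin_cases j <;> first | exact hq0 | exact hq1
    · intro j; fin_cases j <;> simp; omega
    · intro i j; fin_cases i <;> fin_cases j <;> simp <;> omega
    · simp [Fin.sum_univ_three]; ring
    · simp [Fin.sum_univ_three]; ring
    · simp [Fin.sum_univ_three]; linear_combination 2 * t * hqt
  rcases eq_or_ne t 3 with rfl | ht3
  -- For N = 7 the symmetric four-node pattern used below would have nodes 0 and 2, which are too
  -- close; three asymmetric nodes work instead, with weights solving the moment equations.
  · refine isAnticoherent_dicke (K := ![0, 3, 6]) (c := ![2 / 9, 7 / 18, 7 / 18]) ?_ ?_ ?_ ?_ ?_ ?_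
    · intro j; fin_cases j <;> norm_num
    · intro j; fin_cases j <;> norm_num
    · intro i j; fin_cases i <;> fin_cases j <;> norm_num
    all_goals simp [Fin.sum_univ_three]; norm_num
  · have ht4 : 4 ≤ t := by omega
    have ht : (4 : ℝ) ≤ t := by exact_mod_cast ht4
    obtain ⟨s, rfl⟩ : ∃ s, t = s + 1 := ⟨t - 1, by omega⟩
    push_cast at ht
    set M : ℝ := 2 * (s + 1) + 1 with hM
    have hM9 : 9 ≤ M := by linarith
    have hd : 0 < 6 * (M ^ 2 - 9) := by nlinarith
    -- The nodes lie at deviations ±M/2 and ±3/2 from the centre, and the second moment gives q(M² −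
    -- 9)/2 + 9/4 = M(M + 2)/12. The inner gap is 3, and N ≥ 9 makes the outer gaps at least 3 as
    -- well.
    set q : ℝ := (M ^ 2 + 2 * M - 27) / (6 * (M ^ 2 - 9)) with hq
    have hqM : q * (M ^ 2 - 9) = (M ^ 2 + 2 * M - 27) / 6 := by
      rw [hq, div_mul_eq_mul_div, div_eq_div_iff hd.ne' (by norm_num)]
      ring
    have hq0 : 0 ≤ q := div_nonneg (by nlinarith) hd.le
    have hq1 : 0 ≤ 1 / 2 - q := by
      rw [hq, sub_nonneg, div_le_div_iff₀ hd (by norm_num)]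
      nlinarith
    refine isAnticoherent_dicke (K := ![0, s, s + 3, 2 * (s + 1) + 1])
      (c := ![q, 1 / 2 - q, 1 / 2 - q, q]) ?_ ?_ ?_ ?_ ?_ ?_
    · intro j; fin_cases j <;> first | exact hq0 | exact hq1
    · intro j; fin_cases j <;> simp <;> omega
    · intro i j; fin_cases i <;> fin_cases j <;> simp <;> omega
    · simp [Fin.sum_univ_four]; ring
    · simp [Fin.sum_univ_four]; ring
    · simp [Fin.sum_univ_four, ← hM]
      have hs : (s : ℝ) = (M - 3) / 2 := by rw [hM]; ring
      rw [hs]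
      linear_combination (1 / 2) * hqM

end Dicke

/-! ### Rotating the quantization axis -/

section Rotation

variable {N : ℕ}

/-- Every spin direction can be rotated to the `z` axis. -/
lemma exists_rotation {ν : EuclideanSpace ℝ (Fin 3)} (hν : ‖ν‖ = 1) :
    ∃ U : Op (Fin 2), U * Uᴴ = 1 ∧ Uᴴ * U = 1 ∧ pauliAlong ν * U = U * pauli 2 := by
  obtain ⟨U, lam, hU, hU', hD, -⟩ := exists_eigendecomposition (isHermitian_pauliAlong ν)
  set D : Op (Fin 2) := Matrix.diagonal fun k => (lam k : ℂ) with hDd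
  have hσ : pauliAlong ν * U = U * D := by rw [hD, Matrix.mul_assoc, hU', Matrix.mul_one]
  have hD2 : D * D = 1 := by
    have hDσ : D = Uᴴ * pauliAlong ν * U := by
      rw [Matrix.mul_assoc, hσ, ← Matrix.mul_assoc, hU', Matrix.one_mul]
    calc D * D = Uᴴ * pauliAlong ν * (U * Uᴴ) * pauliAlong ν * U := by
          rw [hDσ]; simp only [Matrix.mul_assoc]
      _ = Uᴴ * (pauliAlong ν * pauliAlong ν) * U := by
          rw [hU, Matrix.mul_one]; simp only [Matrix.mul_assoc]
      _ = 1 := by rw [pauliAlong_mul_self hν, Matrix.mul_one, hU']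
  have htr : lam 0 + lam 1 = 0 := by
    have h1 := congrArg Matrix.trace hD
    rw [Matrix.trace_mul_comm, ← Matrix.mul_assoc, hU', Matrix.one_mul, pauliAlong_eq,
      Matrix.trace_fin_two, hDd, Matrix.trace_diagonal, Fin.sum_univ_two] at h1
    simp at h1
    exact_mod_cast h1.symm
  have h0 : lam 0 * lam 0 = 1 := by
    have h1 := congrFun (congrFun hD2 0) 0
    rw [hDd, Matrix.diagonal_mul_diagonal, Matrix.diagonal_apply_eq, Matrix.one_apply_eq] at h1
    exact_mod_cast h1
  rcases mul_self_eq_one_iff.mp h0 with h | h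
  · have h1 : lam 1 = -1 := by linarith
    refine ⟨U, hU, hU', ?_⟩
    rw [hσ]
    congr 1
    ext a b
    fin_cases a <;> fin_cases b <;> simp [hDd, pauli, h, h1]
  · have h1 : lam 1 = 1 := by linarith
    have hx : (pauli 0)ᴴ = pauli 0 := by
      ext a b
      fin_cases a <;> fin_cases b <;> simp [pauli]
    have hxx : pauli 0 * pauli 0 = 1 := by
      rw [← pauliAlong_single, pauliAlong_mul_self (by simp)]
    have hDx : D * pauli 0 = pauli 0 * pauli 2 := by
      ext a b
      fin_cases a <;> fin_cases b <;> simp [hDd, pauli, h, h1]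
    -- The eigenvalues came out in the order −1, 1; σ_x exchanges the two columns.
    refine ⟨U * pauli 0, ?_, ?_, ?_⟩
    · rw [Matrix.conjTranspose_mul, hx, Matrix.mul_assoc, ← Matrix.mul_assoc (pauli 0), hxx,
        Matrix.one_mul, hU]
    · rw [Matrix.conjTranspose_mul, hx, Matrix.mul_assoc, ← Matrix.mul_assoc Uᴴ, hU',
        Matrix.one_mul, hxx]
    · rw [← Matrix.mul_assoc, hσ, Matrix.mul_assoc, hDx, Matrix.mul_assoc]

lemma collectiveSpin_mul_tensorOp {ν : EuclideanSpace ℝ (Fin 3)} {U : Op (Fin 2)}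
    (h : pauliAlong ν * U = U * pauli 2) :
    collectiveSpin N ν * tensorOp (fun _ => U) = tensorOp (fun _ => U) * spinComponent N 2 := by
  rw [collectiveSpin_eq, spinComponent_eq, Matrix.smul_mul, Matrix.mul_smul, Finset.sum_mul,
    Finset.mul_sum]
  congr 1
  refine Finset.sum_congr rfl fun i _ => ?_
  rw [onSite_mul_tensorOp, tensorOp_mul_onSite, h]

lemma conjTranspose_tensorOp_mul_self {U : Op (Fin 2)} (h : Uᴴ * U = 1) :
    (tensorOp fun _ : Fin N => U)ᴴ * tensorOp (fun _ => U) = 1 := by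
  rw [conjTranspose_tensorOp, tensorOp_mul, h, tensorOp_one]

lemma tensorOp_mul_conjTranspose_self {U : Op (Fin 2)} (h : U * Uᴴ = 1) :
    tensorOp (fun _ : Fin N => U) * (tensorOp fun _ => U)ᴴ = 1 := by
  rw [conjTranspose_tensorOp, tensorOp_mul, h, tensorOp_one]

/-- Identical one-qubit operators on all sites commute with permutations, so rotating the
quantization axis stays inside the symmetric subspace. -/
lemma isSymmetricVec_tensorOp_mulVec (U : Op (Fin 2)) {ψ : QIdx N → ℂ} (h : IsSymmetricVec ψ) :
    IsSymmetricVec (tensorOp (fun _ => U) *ᵥ ψ) := by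
  intro π x
  simp only [Matrix.mulVec, dotProduct, tensorOp, Matrix.of_apply]
  rw [← Equiv.sum_comp (Equiv.arrowCongr π.symm (Equiv.refl (Fin 2)))]
  refine Finset.sum_congr rfl fun y _ => ?_
  have e : Equiv.arrowCongr π.symm (Equiv.refl (Fin 2)) y = y ∘ π := by
    ext i
    simp [Equiv.arrowCongr]
  rw [e, h]
  congr 1
  exact Equiv.prod_comp π fun i => U (x i) (y i)

theorem exists_isTwinFock {ν : EuclideanSpace ℝ (Fin 3)} (hν : ‖ν‖ = 1) (hN : Even N) :
    ∃ ψ : QIdx N → ℂ, IsTwinFock ν ψ := by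
  obtain ⟨t, rfl⟩ := hN
  obtain ⟨U, -, hU', hUν⟩ := exists_rotation hν
  set p : ℕ → ℝ := fun k => if k = t then 1 else 0 with hp
  have hp0 : ∀ k, 0 ≤ p k := fun k => by simp only [hp]; split_ifs <;> norm_num
  have hp1 : ∑ k ∈ Finset.range (t + t + 1), p k = 1 := by
    simp only [hp]
    rw [Finset.sum_ite_eq', if_pos (Finset.mem_range.mpr (by omega))]
  refine ⟨tensorOp (fun _ => U) *ᵥ dicke (t + t) p,
    isUnitVec_mulVec (conjTranspose_tensorOp_mul_self hU') (isUnitVec_dicke hp0 hp1),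
    isSymmetricVec_tensorOp_mulVec U (isSymmetricVec_dicke p), ?_⟩
  rw [Matrix.mulVec_mulVec, collectiveSpin_mul_tensorOp hUν, ← Matrix.mulVec_mulVec]
  have h0 : spinComponent (t + t) 2 *ᵥ dicke (t + t) p = 0 := by
    ext x
    rw [spinComponent_two_mulVec, Pi.zero_apply]
    by_cases hx : weight x = t
    · rw [hx]
      push_cast
      ring
    · have : dicke (t + t) p x = 0 := by
        by_contra h
        exact dicke_ne_zero h (if_neg hx)
      rw [this, mul_zero]
  rw [h0, Matrix.mulVec_zero]

end Rotation

/-! ### Extremal eigenvectors -/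

section Extremal

variable {N : ℕ}

/-- The basis state of one qubit with `σ_z = s`. -/
lemma exists_extremal_index {s : ℝ} (hs : s ∈ ({1, -1} : Set ℝ)) :
    ∃ k : Fin 2, pauli 2 * pureState (Pi.single k 1) = (s : ℂ) • pureState (Pi.single k 1) ∧
      ∀ x : QIdx N, (N / 2 - weight x : ℝ) = s * (N / 2) ↔ x = fun _ => k := by
  rcases hs with rfl | rfl
  · refine ⟨0, ?_, fun x => ?_⟩
    · ext a b
      fin_cases a <;> fin_cases b <;>
        simp [pauli, pureState, Matrix.mul_apply, Matrix.vecMulVec_apply]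
    · rw [one_mul, sub_eq_self, Nat.cast_eq_zero, weight, Finset.sum_eq_zero_iff, funext_iff]
      exact ⟨fun h i => Fin.ext (h i (Finset.mem_univ i)), fun h i _ => by rw [h i]; rfl⟩
  · refine ⟨1, ?_, fun x => ?_⟩
    · ext a b
      fin_cases a <;> fin_cases b <;>
        simp [pauli, pureState, Matrix.mul_apply, Matrix.vecMulVec_apply]
    · have h1 : (N / 2 - weight x : ℝ) = -1 * (N / 2) ↔ weight x = N := by
        constructor
        · intro h
          have : (weight x : ℝ) = N := by linarith
          exact_mod_cast this
        · intro h
          rw [h]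
          ring
      have h2 : weight x = N ↔ ∑ i, (x i : ℕ) = ∑ _i : Fin N, 1 := by
        rw [weight, Finset.sum_const, Finset.card_univ, Fintype.card_fin, smul_eq_mul, mul_one]
      rw [h1, h2, Finset.sum_eq_sum_iff_of_le fun i _ => by omega, funext_iff]
      exact ⟨fun h i => Fin.ext (h i (Finset.mem_univ i)), fun h i _ => by rw [h i]; rfl⟩

lemma isUnitVec_single {ι : Type} [Fintype ι] [DecidableEq ι] (k : ι) :
    IsUnitVec (Pi.single k (1 : ℂ)) := by
  rw [IsUnitVec, dotProduct_single, mul_one, Pi.star_apply, Pi.single_eq_same, star_one]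

lemma tensorVec_single (k : Fin 2) :
    tensorVec (fun _ : Fin N => Pi.single k (1 : ℂ)) = Pi.single (fun _ => k) 1 := by
  ext x
  simp only [tensorVec, Pi.single_apply, Finset.prod_ite_zero, Finset.prod_const_one,
    Finset.mem_univ, true_imp_iff, funext_iff]

/-- The operator is diagonal and takes the extremal value on a single basis label, so the eigenspace
is one-dimensional. -/
lemma spinComponent_two_mulVec_eq_iff {s : ℝ} {k : Fin 2}
    (hk : ∀ x : QIdx N, (N / 2 - weight x : ℝ) = s * (N / 2) ↔ x = fun _ => k)
    (ψ : QIdx N → ℂ) :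
    spinComponent N 2 *ᵥ ψ = ((s * (N / 2) : ℝ) : ℂ) • ψ ↔
      ψ = ψ (fun _ => k) • Pi.single (fun _ => k) 1 := by
  rw [funext_iff, funext_iff]
  refine forall_congr' fun x => ?_
  rw [spinComponent_two_mulVec, Pi.smul_apply, Pi.smul_apply, smul_eq_mul, smul_eq_mul]
  by_cases hx : x = fun _ => k
  · rw [(hk x).mpr hx, hx, Pi.single_eq_same, mul_one]
    exact iff_of_true rfl rfl
  · rw [Pi.single_eq_of_ne hx, mul_zero, mul_eq_mul_right_iff, Complex.ofReal_inj, hk x]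
    exact or_iff_right hx

theorem exists_isExtremal {ν : EuclideanSpace ℝ (Fin 3)} (hν : ‖ν‖ = 1) {s : ℝ}
    (hs : s ∈ ({1, -1} : Set ℝ)) : ∃ ψ : QIdx N → ℂ, IsExtremal ν s ψ := by
  obtain ⟨U, -, hU', hUν⟩ := exists_rotation hν
  obtain ⟨k, -, hk⟩ := exists_extremal_index (N := N) hs
  refine ⟨tensorOp (fun _ => U) *ᵥ Pi.single (fun _ => k) 1,
    isUnitVec_mulVec (conjTranspose_tensorOp_mul_self hU') (isUnitVec_single _), ?_⟩
  rw [Matrix.mulVec_mulVec, collectiveSpin_mul_tensorOp hUν, ← Matrix.mulVec_mulVec,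
    (spinComponent_two_mulVec_eq_iff hk _).mpr (by rw [Pi.single_eq_same, one_smul]),
    Matrix.mulVec_smul]

/-- Extremal eigenvectors are products of identical polarized qubit states. -/
theorem IsExtremal.exists_polarized {ν : EuclideanSpace ℝ (Fin 3)} (hν : ‖ν‖ = 1) {s : ℝ}
    (hs : s ∈ ({1, -1} : Set ℝ)) {ψ : QIdx N → ℂ} (h : IsExtremal ν s ψ) :
    ∃ τ : Op (Fin 2), IsState τ ∧ pauliAlong ν * τ = (s : ℂ) • τ ∧
      pureState ψ = tensorOp fun _ => τ := by
  obtain ⟨U, hU, hU', hUν⟩ := exists_rotation hν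
  obtain ⟨k, hkσ, hk⟩ := exists_extremal_index (N := N) hs
  set W : Op (QIdx N) := tensorOp fun _ => U with hW
  have hWW : Wᴴ * W = 1 := conjTranspose_tensorOp_mul_self hU'
  have hWW' : W * Wᴴ = 1 := tensorOp_mul_conjTranspose_self hU
  have hψ : W *ᵥ (Wᴴ *ᵥ ψ) = ψ := by rw [Matrix.mulVec_mulVec, hWW', Matrix.one_mulVec]
  have hu : IsUnitVec (Wᴴ *ᵥ ψ) :=
    isUnitVec_mulVec (by rwa [Matrix.conjTranspose_conjTranspose]) h.1
  have hc : Wᴴ * collectiveSpin N ν = spinComponent N 2 * Wᴴ := by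
    have h1 := congrArg Matrix.conjTranspose (collectiveSpin_mul_tensorOp (N := N) hUν)
    rwa [Matrix.conjTranspose_mul, Matrix.conjTranspose_mul, (isHermitian_collectiveSpin ν).eq,
      (isHermitian_spinComponent 2).eq] at h1
  have he : spinComponent N 2 *ᵥ (Wᴴ *ᵥ ψ) = ((s * (N / 2) : ℝ) : ℂ) • (Wᴴ *ᵥ ψ) := by
    rw [Matrix.mulVec_mulVec, ← hc, ← Matrix.mulVec_mulVec, h.2, Matrix.mulVec_smul]
  rw [spinComponent_two_mulVec_eq_iff hk] at he
  generalize (Wᴴ *ᵥ ψ) (fun _ => k) = c at he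
  -- The remaining freedom is a phase, which drops out of the projector.
  have hcc : c * star c = 1 := by
    rw [he, IsUnitVec, star_smul, smul_dotProduct, dotProduct_smul, isUnitVec_single] at hu
    simpa [mul_comm] using hu
  refine ⟨U * pureState (Pi.single k 1) * Uᴴ, ?_, ?_, ?_⟩
  · rw [← pureState_mulVec]
    exact isState_pureState (isUnitVec_mulVec hU' (isUnitVec_single k))
  · rw [← Matrix.mul_assoc, ← Matrix.mul_assoc, hUν, Matrix.mul_assoc U, hkσ, Matrix.mul_smul,
      Matrix.smul_mul]
  · have h1 : pureState (c • Pi.single (fun _ : Fin N => k) (1 : ℂ)) =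
        tensorOp fun _ => pureState (Pi.single k 1) := by
      rw [← pureState_tensorVec, tensorVec_single, pureState, star_smul, Matrix.smul_vecMulVec,
        Matrix.vecMulVec_smul, smul_smul, hcc, one_smul, pureState]
    rw [← hψ, pureState_mulVec, he, h1, hW, conjTranspose_tensorOp, tensorOp_mul, tensorOp_mul]

theorem worstCase_of_isExtremal {ν : EuclideanSpace ℝ (Fin 3)} (hν : ‖ν‖ = 1) {s : ℝ}
    (hs : s ∈ ({1, -1} : Set ℝ)) {ψ : QIdx N → ℂ} (h : IsExtremal ν s ψ) :
    pureState ψ ∈ sepStates N ∧ worstCase (planeAxes ν) (pureState ψ) = N := by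
  obtain ⟨τ, hτ, hντ, he⟩ := h.exists_polarized hν hs
  refine ⟨he ▸ tensorOp_mem_sepStates fun _ => hτ,
    worstCase_eq_of_forall (exists_mem_planeAxes ν) fun n hn => ?_⟩
  have hs2 : (s : ℂ) ≠ 0 := by rcases hs with rfl | rfl <;> norm_num
  have hτν : τ * pauliAlong ν = (s : ℂ) • τ := by
    have h1 := congrArg Matrix.conjTranspose hντ
    rwa [Matrix.conjTranspose_mul, Matrix.conjTranspose_smul, hτ.1.isHermitian.eq,
      (isHermitian_pauliAlong ν).eq, Complex.star_def, Complex.conj_ofReal] at h1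
  -- For n orthogonal to ν the two Pauli operators anticommute, while ν·σ acts on τ as the nonzero
  -- scalar `s` from either side. Hence every qubit has the full variance 1/4.
  have h0 : (τ * pauliAlong n).trace = 0 := by
    have h1 : (τ * (pauliAlong ν * pauliAlong n + pauliAlong n * pauliAlong ν)).trace = 0 := by
      rw [pauliAlong_mul_add_mul, hn.2, mul_zero, Complex.ofReal_zero, zero_smul, Matrix.mul_zero,
        Matrix.trace_zero]
    have h2 : (τ * (pauliAlong n * pauliAlong ν)).trace = s * (τ * pauliAlong n).trace := by
      rw [← Matrix.mul_assoc, Matrix.trace_mul_comm, ← Matrix.mul_assoc, hντ, Matrix.smul_mul,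
        Matrix.trace_smul, smul_eq_mul]
    rw [Matrix.mul_add, Matrix.trace_add, h2, ← Matrix.mul_assoc, hτν, Matrix.smul_mul,
      Matrix.trace_smul, smul_eq_mul, ← two_mul] at h1
    exact ((mul_eq_zero.mp ((mul_eq_zero.mp h1).resolve_left two_ne_zero)).resolve_left hs2)
  rw [qfi_pureState h.1 (isHermitian_collectiveSpin n), he, variance_tensorOp (fun _ => hτ) hn.1,
    h0]
  simp

end Extremal

end SpinMetrology

theorem mainTheorem5 (N : ℕ) (ν : EuclideanSpace ℝ (Fin 3)) (hν : ‖ν‖ = 1) :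
    -- the minima over the axes exist
    (∀ ρ ∈ SpinMetrology.allStates N,
      IsLeast (SpinMetrology.sensitivities (SpinMetrology.planeAxes ν) ρ)
        (SpinMetrology.worstCase (SpinMetrology.planeAxes ν) ρ) ∧
      IsLeast (SpinMetrology.sensitivities SpinMetrology.allAxes ρ)
        (SpinMetrology.worstCase SpinMetrology.allAxes ρ)) ∧
    SpinMetrology.sepStates N ⊆ SpinMetrology.allStates N ∧
    -- the bounds, for every number of qubits
    (∀ ρ ∈ SpinMetrology.allStates N,
      SpinMetrology.worstCase (SpinMetrology.planeAxes ν) ρ ≤ (N : ℝ) * (N + 2) / 2 ∧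
      SpinMetrology.worstCase SpinMetrology.allAxes ρ ≤ (N : ℝ) * (N + 2) / 3) ∧
    (∀ ρ ∈ SpinMetrology.sepStates N,
      SpinMetrology.worstCase (SpinMetrology.planeAxes ν) ρ ≤ N ∧
      SpinMetrology.worstCase SpinMetrology.allAxes ρ ≤ 2 / 3 * (N : ℝ)) ∧
    -- all states, planar axes
    (∀ ψ : SpinMetrology.QIdx N → ℂ, SpinMetrology.IsTwinFock ν ψ →
      SpinMetrology.pureState ψ ∈ SpinMetrology.allStates N ∧
      SpinMetrology.worstCase (SpinMetrology.planeAxes ν) (SpinMetrology.pureState ψ) =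
        (N : ℝ) * (N + 2) / 2) ∧
    (Even N →
      (∃ ψ : SpinMetrology.QIdx N → ℂ, SpinMetrology.IsTwinFock ν ψ) ∧
      SpinMetrology.LimitAttained (SpinMetrology.allStates N) (SpinMetrology.planeAxes ν)
        ((N : ℝ) * (N + 2) / 2)) ∧
    -- all states, axes in three-dimensional space
    (∀ ψ : SpinMetrology.QIdx N → ℂ, SpinMetrology.IsAnticoherent ψ →
      SpinMetrology.pureState ψ ∈ SpinMetrology.allStates N ∧
      SpinMetrology.worstCase SpinMetrology.allAxes (SpinMetrology.pureState ψ) =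
        (N : ℝ) * (N + 2) / 3) ∧
    (N = 4 ∨ 6 ≤ N →
      (∃ ψ : SpinMetrology.QIdx N → ℂ, SpinMetrology.IsAnticoherent ψ) ∧
      SpinMetrology.LimitAttained (SpinMetrology.allStates N) SpinMetrology.allAxes
        ((N : ℝ) * (N + 2) / 3)) ∧
    -- separable states, planar axes
    (∀ s ∈ ({1, -1} : Set ℝ),
      (∃ ψ : SpinMetrology.QIdx N → ℂ, SpinMetrology.IsExtremal ν s ψ) ∧
      ∀ ψ : SpinMetrology.QIdx N → ℂ, SpinMetrology.IsExtremal ν s ψ →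
        (∃ τ : SpinMetrology.Op (Fin 2), SpinMetrology.IsState τ ∧
          SpinMetrology.pauliAlong ν * τ = (s : ℂ) • τ ∧
          SpinMetrology.pureState ψ = SpinMetrology.tensorOp fun _ => τ) ∧
        SpinMetrology.pureState ψ ∈ SpinMetrology.sepStates N ∧
        SpinMetrology.worstCase (SpinMetrology.planeAxes ν) (SpinMetrology.pureState ψ) = N) ∧
    SpinMetrology.LimitAttained (SpinMetrology.sepStates N) (SpinMetrology.planeAxes ν) N ∧
    -- separable states, axes in three-dimensional space
    (∀ ψ : SpinMetrology.QIdx N → ℂ, SpinMetrology.IsIsotropicProduct ψ →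
      SpinMetrology.pureState ψ ∈ SpinMetrology.sepStates N ∧
      SpinMetrology.worstCase SpinMetrology.allAxes (SpinMetrology.pureState ψ) =
        2 / 3 * (N : ℝ)) ∧
    (3 ≤ N →
      (∃ ψ : SpinMetrology.QIdx N → ℂ, SpinMetrology.IsIsotropicProduct ψ) ∧
      SpinMetrology.LimitAttained (SpinMetrology.sepStates N) SpinMetrology.allAxes
        (2 / 3 * (N : ℝ))) := by
  open SpinMetrology in
  refine ⟨fun ρ hρ => ⟨isLeast_worstCase (isCompact_planeAxes ν) (exists_mem_planeAxes ν) hρ,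
      isLeast_worstCase isCompact_allAxes nonempty_allAxes hρ⟩,
    sepStates_subset_allStates,
    fun ρ hρ => ⟨worstCase_planeAxes_le_of_isState hν hρ, worstCase_allAxes_le_of_isState hρ⟩,
    fun ρ hρ => ⟨worstCase_planeAxes_le_of_mem_sepStates hν hρ,
      worstCase_allAxes_le_of_mem_sepStates hρ⟩,
    fun ψ hψ => ⟨isState_pureState hψ.1, worstCase_of_isTwinFock hν hψ⟩,
    fun hN => ?_,
    fun ψ hψ => ⟨isState_pureState hψ.1, worstCase_of_isAnticoherent hψ⟩,
    fun hN => ?_,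
    fun s hs => ⟨exists_isExtremal hν hs, fun ψ hψ =>
      ⟨hψ.exists_polarized hν hs, worstCase_of_isExtremal hν hs hψ⟩⟩,
    ?_,
    fun ψ hψ => worstCase_of_isIsotropicProduct hψ,
    fun hN => ?_⟩
  · obtain ⟨ψ, hψ⟩ := exists_isTwinFock hν hN
    exact ⟨⟨ψ, hψ⟩, limitAttained_of_le (fun ρ hρ => worstCase_planeAxes_le_of_isState hν hρ)
      (isState_pureState hψ.1) (worstCase_of_isTwinFock hν hψ)⟩
  · obtain ⟨ψ, hψ⟩ := exists_isAnticoherent hN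
    exact ⟨⟨ψ, hψ⟩, limitAttained_of_le (fun ρ hρ => worstCase_allAxes_le_of_isState hρ)
      (isState_pureState hψ.1) (worstCase_of_isAnticoherent hψ)⟩
  · have h1 : (1 : ℝ) ∈ ({1, -1} : Set ℝ) := Or.inl rfl
    obtain ⟨ψ, hψ⟩ := exists_isExtremal (N := N) hν h1
    obtain ⟨hsep, hval⟩ := worstCase_of_isExtremal hν h1 hψ
    exact limitAttained_of_le (fun ρ hρ => worstCase_planeAxes_le_of_mem_sepStates hν hρ) hsep hval
  · obtain ⟨ψ, hψ⟩ := exists_isIsotropicProduct hN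
    obtain ⟨hsep, hval⟩ := worstCase_of_isIsotropicProduct hψ
    exact ⟨⟨ψ, hψ⟩,
      limitAttained_of_le (fun ρ hρ => worstCase_allAxes_le_of_mem_sepStates hρ) hsep hval⟩
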